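/- Let $V$ be a finite-dimensional real vector space of dimension $n+1$ and let $A\in\operatorname{End}(V)$ be an endomorphism all of whose complex eigenvalues lie on the imaginary axis. Let $\mathbb{P}(V)$ be the projective space of lines in $V$ with its quotient topology and a compatible metric $\mathrm{d}$, write $\mathbb{P}x$ for the line through $x\neq 0$, and let $\psi_A(t,\mathbb{P}x)=\mathbb{P}e^{At}x$ be the projective flow of $A$. A point $p$ is recurrent if it lies in its own $\omega$-limit set, and the stable manifold of $p$ is $\{q\in\mathbb{P}(V) : \mathrm{d}(\psi_A(t,p),\psi_A(t,q))\to 0 \text{ as } t\to\infty\}$. The space $V$ is a direct sum of real Jordan subspaces of $A$; fix any such decomposition. The size of a real Jordan subspace is its dimension if it belongs to the eigenvalue $0$, and half of its dimension if it belongs to a pair $\pm i\alpha$ with $\alpha\neq 0$. Let $s_{\max}$ be the largest size that occurs, let $J_s$ be the sum of the Jordan subspaces of size $s$, and write $x=x_1\oplus\cdots\oplus x_{s_{\max}}$ with $x_s\in J_s$ for $x\in V$. Let $E_A$ be the sum of the real eigenspaces $V\cap(E(i\alpha)\oplus E(-i\alpha))$ of $A$, $\alpha\in\mathbb{R}$ (for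 $\alpha=0$ this is $\ker A$), where $E(\mu)$ is the eigenspace of the complexification of $A$ for $\mu$, let $d_s=\dim(J_s\cap E_A)$, and put $$\mathcal{R}_s=\{\mathbb{P}x : 0\neq x\in E_A,\ x_1=\cdots=x_{s-1}=0\}\qquad(1\le s\le s_{\max}),\qquad \mathcal{R}_{s_{\max}+1}=\emptyset .$$ Then, for every $s\in\{1,\dots,s_{\max}\}$, every point of $\mathcal{R}_s\setminus\mathcal{R}_{s+1}$ is recurrent for $\psi_A$, and the topological dimension of its stable manifold is the same for all points of $\mathcal{R}_s\setminus\mathcal{R}_{s+1}$, namely $$D_s = n+1-\sum_{i=s}^{s_{\max}}(i+1-s)\,d_i .$$ -/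

import Mathlib

open Filter Topology Module
open scoped LinearAlgebra.Projectivization

noncomputable section

/-! ### Stable manifolds and recurrent points of continuous flows -/

/-- The stable manifold of `x`: all points whose forward trajectory is asymptotic to the one
of `x`. -/
def stableManifold {X : Type*} [MetricSpace X] (φ : Flow ℝ X) (x : X) : Set X :=
  {y | Tendsto (fun t : ℝ => dist (φ t x) (φ t y)) atTop (𝓝 0)}

/-- The set of recurrent points: those that lie in their own ω-limit set. -/
def recurrentSet {X : Type*} [TopologicalSpace X] (φ : Flow ℝ X) : Set X :=
  {x | x ∈ omegaLimit atTop φ {x}}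

/-! ### Projective space as a metric space -/

section Projective

variable {V : Type*} [NormedAddCommGroup V] [NormedSpace ℝ V]

/-- The quotient topology on projective space. -/
instance projTopology : TopologicalSpace (ℙ ℝ V) :=
  TopologicalSpace.coinduced (Projectivization.mk' ℝ) inferInstance

/-- The unit vector in the direction of `v`. -/
def unitVec (v : V) : V := ‖v‖⁻¹ • v

theorem norm_unitVec {v : V} (hv : v ≠ 0) : ‖unitVec v‖ = 1 := by
  rw [unitVec, norm_smul, norm_inv, norm_norm, inv_mul_cancel₀ (norm_ne_zero_iff.2 hv)]

theorem unitVec_smul (a : ℝ) (ha : a ≠ 0) (v : V) :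
    unitVec (a • v) = unitVec v ∨ unitVec (a • v) = -unitVec v := by
  unfold unitVec
  rw [norm_smul, Real.norm_eq_abs, smul_smul, mul_inv]
  rcases lt_or_gt_of_ne ha with h | h
  · right
    rw [abs_of_neg h, ← neg_smul]
    congr 1
    field_simp
  · left
    rw [abs_of_pos h]
    congr 1
    field_simp

theorem min_norm_congr {V : Type*} [NormedAddCommGroup V] {x x' y : V} (h : x' = x ∨ x' = -x) :
    min ‖x' - y‖ ‖x' + y‖ = min ‖x - y‖ ‖x + y‖ := by
  rcases h with rfl | rfl
  · rfl
  · rw [min_comm, show -x + y = -(x - y) by abel, show -x - y = -(x + y) by abel,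
      norm_neg, norm_neg]

theorem min_norm_symm {V : Type*} [NormedAddCommGroup V] (x y : V) : min ‖x - y‖ ‖x + y‖ = min ‖y - x‖ ‖y + x‖ := by
  rw [norm_sub_rev, add_comm]

/-- The distance of the lines through `z` and `w` is the minimum of
`‖z / ‖z‖ - w / ‖w‖‖` and `‖z / ‖z‖ + w / ‖w‖‖`. -/
def projDist (p q : ℙ ℝ V) : ℝ :=
  min ‖unitVec p.rep - unitVec q.rep‖ ‖unitVec p.rep + unitVec q.rep‖

theorem projDist_mk (z w : V) (hz : z ≠ 0) (hw : w ≠ 0) :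
    projDist (Projectivization.mk ℝ z hz) (Projectivization.mk ℝ w hw) =
      min ‖unitVec z - unitVec w‖ ‖unitVec z + unitVec w‖ := by
  obtain ⟨a, ha⟩ := Projectivization.exists_smul_eq_mk_rep ℝ z hz
  obtain ⟨b, hb⟩ := Projectivization.exists_smul_eq_mk_rep ℝ w hw
  unfold projDist
  rw [← ha, ← hb, Units.smul_def, Units.smul_def, min_norm_congr (unitVec_smul _ a.ne_zero z),
    min_norm_symm, min_norm_congr (unitVec_smul _ b.ne_zero w), min_norm_symm]

/-- The distance `projDist` turns projective space into a metric space. -/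
abbrev projMetricCore : MetricSpace (ℙ ℝ V) where
  dist := projDist
  dist_self p := by simp [projDist]
  dist_comm p q := min_norm_symm _ _
  dist_triangle p q r := by
    simp only [projDist]
    set x := unitVec p.rep
    set y := unitVec q.rep
    set z := unitVec r.rep
    have h1 : ‖x - z‖ ≤ ‖x - y‖ + ‖y - z‖ := norm_sub_le_norm_sub_add_norm_sub x y z
    have h2 : ‖x + z‖ ≤ ‖x - y‖ + ‖y + z‖ := by
      calc ‖x + z‖ = ‖(x - y) + (y + z)‖ := by congr 1; abel
        _ ≤ _ := norm_add_le _ _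
    have h3 : ‖x + z‖ ≤ ‖x + y‖ + ‖y - z‖ := by
      calc ‖x + z‖ = ‖(x + y) - (y - z)‖ := by congr 1; abel
        _ ≤ _ := norm_sub_le _ _
    have h4 : ‖x - z‖ ≤ ‖x + y‖ + ‖y + z‖ := by
      calc ‖x - z‖ = ‖(x + y) - (y + z)‖ := by congr 1; abel
        _ ≤ _ := norm_sub_le _ _
    grind
  eq_of_dist_eq_zero := by
    intro p q h
    induction p using Projectivization.ind with | h v hv
    induction q using Projectivization.ind with | h w hw
    have h' : min ‖unitVec v - unitVec w‖ ‖unitVec v + unitVec w‖ = 0 :=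
      (projDist_mk v w hv hw).symm.trans h
    have hv' : v = ‖v‖ • unitVec v := by
      rw [unitVec, smul_smul, mul_inv_cancel₀ (norm_ne_zero_iff.2 hv), one_smul]
    rw [Projectivization.mk_eq_mk_iff']
    rcases min_choice ‖unitVec v - unitVec w‖ ‖unitVec v + unitVec w‖ with h1 | h1
    · rw [h1, norm_eq_zero, sub_eq_zero] at h'
      refine ⟨‖v‖ * ‖w‖⁻¹, ?_⟩
      conv_rhs => rw [hv', h', unitVec, smul_smul]
    · rw [h1, norm_eq_zero, add_eq_zero_iff_eq_neg] at h'
      refine ⟨-(‖v‖ * ‖w‖⁻¹), ?_⟩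
      conv_rhs => rw [hv', h', unitVec, smul_neg, smul_smul, ← neg_smul]

theorem continuous_unitVec : Continuous (fun v : {v : V // v ≠ 0} => unitVec v.1) := by
  unfold unitVec
  exact (continuous_subtype_val.norm.inv₀ fun v => norm_ne_zero_iff.2 v.2).smul
    continuous_subtype_val

/-- The metric induces the quotient topology. -/
theorem projTopology_eq :
    (projTopology : TopologicalSpace (ℙ ℝ V)) =
      projMetricCore.toPseudoMetricSpace.toUniformSpace.toTopologicalSpace := by
  apply le_antisymm
  · refine continuous_iff_coinduced_le.1 ?_
    let _ := projMetricCore (V := V)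
    rw [Metric.continuous_iff']
    intro v ε hε
    have h := (Metric.continuous_iff'.1 (continuous_unitVec (V := V))) v ε hε
    filter_upwards [h] with w hw
    refine lt_of_le_of_lt (b := dist (unitVec w.1) (unitVec v.1)) ?_ hw
    rw [dist_eq_norm]
    exact (projDist_mk w.1 v.1 w.2 v.2).trans_le (min_le_left _ _)
  · intro U hU
    have hU' : IsOpen (Projectivization.mk' ℝ ⁻¹' U : Set {v : V // v ≠ 0}) := hU
    let _ := projMetricCore (V := V)
    refine Metric.isOpen_iff.2 fun p hp => ?_
    induction p using Projectivization.ind with | h v hv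
    have hu : unitVec v ≠ 0 := norm_ne_zero_iff.1 (by rw [norm_unitVec hv]; exact one_ne_zero)
    have hmk : ∀ (w : V) (hw : w ≠ 0) (a : ℝ) (x : {v : V // v ≠ 0}), x.1 = a • unitVec w →
        Projectivization.mk' ℝ x = Projectivization.mk ℝ w hw := by
      intro w hw a x hx
      rw [Projectivization.mk'_eq_mk, Projectivization.mk_eq_mk_iff']
      exact ⟨a * ‖w‖⁻¹, by rw [hx, unitVec, smul_smul]⟩
    have hmem : (⟨unitVec v, hu⟩ : {v : V // v ≠ 0}) ∈
        (Projectivization.mk' ℝ ⁻¹' U : Set {v : V // v ≠ 0}) := by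
      rw [Set.mem_preimage, hmk v hv 1 ⟨unitVec v, hu⟩ (one_smul _ _).symm]
      exact hp
    obtain ⟨ε, hε, hball⟩ := Metric.isOpen_iff.1 hU' _ hmem
    refine ⟨ε, hε, fun q hq => ?_⟩
    induction q using Projectivization.ind with | h w hw
    have hq' : min ‖unitVec w - unitVec v‖ ‖unitVec w + unitVec v‖ < ε :=
      (projDist_mk w v hw hv).symm.trans_lt hq
    have hu' : unitVec w ≠ 0 := norm_ne_zero_iff.1 (by rw [norm_unitVec hw]; exact one_ne_zero)
    rcases min_lt_iff.1 hq' with h | h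
    · have h1 : (⟨unitVec w, hu'⟩ : {v : V // v ≠ 0}) ∈ Metric.ball ⟨unitVec v, hu⟩ ε := by
        rw [Metric.mem_ball, Subtype.dist_eq, dist_eq_norm]
        exact h
      have h2 := hball h1
      rwa [Set.mem_preimage, hmk w hw 1 ⟨unitVec w, hu'⟩ (one_smul _ _).symm] at h2
    · have h1 : (⟨-unitVec w, neg_ne_zero.2 hu'⟩ : {v : V // v ≠ 0}) ∈
          Metric.ball ⟨unitVec v, hu⟩ ε := by
        rw [Metric.mem_ball, Subtype.dist_eq, dist_eq_norm]
        rwa [show -unitVec w - unitVec v = -(unitVec w + unitVec v) by abel, norm_neg]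
      have h2 := hball h1
      rwa [Set.mem_preimage, hmk w hw (-1) ⟨-unitVec w, neg_ne_zero.2 hu'⟩
        (neg_one_smul _ _).symm] at h2

/-- Projective space with the quotient topology and the metric `projDist`. -/
instance projMetric : MetricSpace (ℙ ℝ V) :=
  projMetricCore.replaceTopology projTopology_eq

/-- The projection of the nonzero vectors onto projective space is an open quotient map. -/
theorem isOpenQuotientMap_mk' :
    IsOpenQuotientMap (Projectivization.mk' ℝ : {v : V // v ≠ 0} → ℙ ℝ V) := by
  refine ⟨fun p => ?_, continuous_coinduced_rng, fun U hU => ?_⟩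
  · induction p using Projectivization.ind with | h v hv
    exact ⟨⟨v, hv⟩, rfl⟩
  · change IsOpen (Projectivization.mk' ℝ ⁻¹' (Projectivization.mk' ℝ '' U))
    have : (Projectivization.mk' ℝ ⁻¹' (Projectivization.mk' ℝ '' U) : Set {v : V // v ≠ 0}) =
        ⋃ a : ℝˣ, (fun v : {v : V // v ≠ 0} =>
          (⟨(a : ℝ) • v.1, smul_ne_zero a.ne_zero v.2⟩ : {v : V // v ≠ 0})) ⁻¹' U := by
      ext v
      simp only [Set.mem_preimage, Set.mem_image, Set.mem_iUnion]
      constructor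
      · rintro ⟨w, hw, h⟩
        rw [Projectivization.mk'_eq_mk, Projectivization.mk'_eq_mk,
          Projectivization.mk_eq_mk_iff] at h
        obtain ⟨a, ha⟩ := h
        refine ⟨a, ?_⟩
        have h2 : (⟨(a : ℝ) • v.1, smul_ne_zero a.ne_zero v.2⟩ : {v : V // v ≠ 0}) = w :=
          Subtype.ext ha
        rwa [h2]
      · rintro ⟨a, ha⟩
        refine ⟨_, ha, ?_⟩
        rw [Projectivization.mk'_eq_mk, Projectivization.mk'_eq_mk,
          Projectivization.mk_eq_mk_iff]
        exact ⟨a, rfl⟩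
    rw [this]
    refine isOpen_iUnion fun a => hU.preimage ?_
    exact (continuous_subtype_val.const_smul (a : ℝ)).subtype_mk _

end Projective

/-! ### The linear flow and the projective flow of an endomorphism -/

section ProjFlow

variable {V : Type*} [NormedAddCommGroup V] [NormedSpace ℝ V] [FiniteDimensional ℝ V]

/-- The time-`t` map `exp (t A)` of the linear flow of `A`. -/
def expFlow (A : End ℝ V) (t : ℝ) : V →L[ℝ] V :=
  NormedSpace.exp (t • LinearMap.toContinuousLinearMap A)

theorem expFlow_zero (A : End ℝ V) : expFlow A 0 = 1 := by
  rw [expFlow, zero_smul, NormedSpace.exp_zero]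

theorem expFlow_add (A : End ℝ V) (s t : ℝ) :
    expFlow A (s + t) = expFlow A s * expFlow A t := by
  have : CompleteSpace V := FiniteDimensional.complete ℝ V
  let _ : NormedAlgebra ℚ (V →L[ℝ] V) := NormedAlgebra.restrictScalars ℚ ℝ _
  rw [expFlow, add_smul, NormedSpace.exp_add_of_commute]
  · rfl
  · exact ((Commute.refl _).smul_left s).smul_right t

theorem expFlow_injective (A : End ℝ V) (t : ℝ) :
    Function.Injective (expFlow A t : V →ₗ[ℝ] V) := by
  refine Function.LeftInverse.injective (g := expFlow A (-t)) fun x => ?_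
  change (expFlow A (-t) * expFlow A t) x = x
  rw [← expFlow_add, neg_add_cancel, expFlow_zero]
  rfl

theorem continuous_expFlow (A : End ℝ V) : Continuous (expFlow A) := by
  have : CompleteSpace V := FiniteDimensional.complete ℝ V
  let _ : NormedAlgebra ℚ (V →L[ℝ] V) := NormedAlgebra.restrictScalars ℚ ℝ _
  exact NormedSpace.exp_continuous.comp (continuous_id.smul continuous_const)

/-- The flow on projective space that sends the line through `x` to the line through
`exp (t A) x` at time `t`. -/
def projFlow (A : End ℝ V) : Flow ℝ (ℙ ℝ V) where
  toFun t := Projectivization.map (expFlow A t : V →ₗ[ℝ] V) (expFlow_injective A t)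
  cont' := by
    have hq : IsOpenQuotientMap
        (Prod.map id (Projectivization.mk' ℝ) : ℝ × {v : V // v ≠ 0} → ℝ × ℙ ℝ V) :=
      IsOpenQuotientMap.id.prodMap isOpenQuotientMap_mk'
    rw [hq.isQuotientMap.continuous_iff]
    have hne : ∀ z : ℝ × {v : V // v ≠ 0}, expFlow A z.1 z.2.1 ≠ 0 := fun z h =>
      z.2.2 (expFlow_injective A z.1 (by simpa using h))
    have hc : Continuous fun z : ℝ × {v : V // v ≠ 0} =>
        (⟨expFlow A z.1 z.2.1, hne z⟩ : {v : V // v ≠ 0}) :=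
      (((continuous_expFlow A).comp continuous_fst).clm_apply
        (continuous_subtype_val.comp continuous_snd)).subtype_mk _
    exact isOpenQuotientMap_mk'.continuous.comp hc
  map_add' s t p := by
    induction p using Projectivization.ind with | h v hv
    simp only [Projectivization.map_mk]
    congr 1
    exact congrArg (fun L : V →L[ℝ] V => L v) (expFlow_add A s t)
  map_zero' p := by
    induction p using Projectivization.ind with | h v hv
    simp only [Projectivization.map_mk]
    congr 1
    exact congrArg (fun L : V →L[ℝ] V => L v) (expFlow_zero A)

end ProjFlow

/-! ### Spectrum, real eigenspaces, and the real Jordan decomposition -/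

section Jordan

variable {V : Type*} [AddCommGroup V] [Module ℝ V]

/-- All complex eigenvalues of `A`, that is, all eigenvalues of its complexification, lie on the
imaginary axis. -/
def HasImaginarySpectrum (A : End ℝ V) : Prop :=
  ∀ μ : ℂ, End.HasEigenvalue (LinearMap.baseChange ℂ A) μ → μ.re = 0

/-- The real eigenspace `V ∩ (E(iα) + E(-iα))`, where `E(μ)` is the eigenspace of the
complexification of `A` for `μ`, and `V` sits in its complexification by `x ↦ 1 ⊗ x`. -/
def realEigenspace (A : End ℝ V) (α : ℝ) : Submodule ℝ V :=
  ((End.eigenspace (LinearMap.baseChange ℂ A) (Complex.I * α) ⊔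
      End.eigenspace (LinearMap.baseChange ℂ A) (-(Complex.I * α))).restrictScalars ℝ).comap
    (TensorProduct.mk ℝ ℂ V 1)

/-- The sum of all real eigenspaces of `A`. -/
def eigenSum (A : End ℝ V) : Submodule ℝ V := ⨆ α : ℝ, realEigenspace A α

/-- `W` is a real Jordan subspace of `A` with Jordan block size `s`. Either it belongs to the real
eigenvalue `0` and has a basis `e 1, …, e s` with `A (e k) = e (k - 1)`, or it belongs to a pair
`iα, -iα` with `α ≠ 0` and has a basis `e 1, …, e s, f 1, …, f s` with
`A (e k) = α f k + e (k - 1)` and `A (f k) = -α e k + f (k - 1)`; here `e 0 = f 0 = 0`. -/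
def IsRealJordanSubspace (A : End ℝ V) (W : Submodule ℝ V) (s : ℕ) : Prop :=
  (∃ e : ℕ → V, e 0 = 0 ∧ (∀ k < s, A (e (k + 1)) = e k) ∧
    LinearIndependent ℝ (fun k : Fin s => e (k + 1)) ∧
    Submodule.span ℝ (Set.range fun k : Fin s => e (k + 1)) = W) ∨
  (∃ α : ℝ, α ≠ 0 ∧ ∃ e f : ℕ → V, e 0 = 0 ∧ f 0 = 0 ∧
    (∀ k < s, A (e (k + 1)) = α • f (k + 1) + e k ∧
      A (f (k + 1)) = -(α • e (k + 1)) + f k) ∧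
    LinearIndependent ℝ
      (Sum.elim (fun k : Fin s => e (k + 1)) (fun k : Fin s => f (k + 1))) ∧
    Submodule.span ℝ (Set.range
      (Sum.elim (fun k : Fin s => e (k + 1)) (fun k : Fin s => f (k + 1)))) = W)

/-- A decomposition of `V` into real Jordan subspaces of `A` (with purely imaginary
eigenvalues). -/
structure RealJordanDecomposition (A : End ℝ V) where
  /-- the number of Jordan subspaces -/
  num : ℕ
  /-- the Jordan subspaces -/
  block : Fin num → Submodule ℝ V
  /-- the sizes of the Jordan blocks, that is, the dimensions of the complex Jordan subspaces -/
  size : Fin num → ℕ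
  size_pos : ∀ i, 1 ≤ size i
  isJordan : ∀ i, IsRealJordanSubspace A (block i) (size i)
  internal : DirectSum.IsInternal block

namespace RealJordanDecomposition

variable {A : End ℝ V} (J : RealJordanDecomposition A)

/-- The largest size of a Jordan block. -/
def sMax : ℕ := Finset.univ.sup J.size

/-- `J_s`, the sum of all Jordan subspaces with block size `s`. -/
def sumOfSize (s : ℕ) : Submodule ℝ V := ⨆ i : {i // J.size i = s}, J.block i

/-- `d_s`, the dimension of the sum of the real eigenspaces inside `J_s`. -/
def d (s : ℕ) : ℕ := finrank ℝ ↥(J.sumOfSize s ⊓ eigenSum A)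

/-- The component of a vector in the `i`-th Jordan subspace. -/
def blockComponent (i : Fin J.num) : V →ₗ[ℝ] V :=
  (J.block i).subtype ∘ₗ DirectSum.component ℝ (Fin J.num) (fun i => J.block i) i ∘ₗ
    ((LinearEquiv.ofBijective (DirectSum.coeLinearMap J.block) J.internal).symm :
      V →ₗ[ℝ] DirectSum (Fin J.num) fun i => J.block i)

/-- The component `x_s` of a vector `x` in `J_s`. -/
def component (s : ℕ) : V →ₗ[ℝ] V :=
  ∑ i ∈ Finset.univ.filter (fun i => J.size i = s), J.blockComponent i

/-- The projective subspace `R_s` of all lines through vectors `x ≠ 0` in the sum of the real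
eigenspaces with `x_1 = ⋯ = x_{s-1} = 0`. It is empty for `s > s_max`. -/
def recSubspace (s : ℕ) : Set (ℙ ℝ V) :=
  {p | ∃ (x : V) (hx : x ≠ 0), p = Projectivization.mk ℝ x hx ∧ x ∈ eigenSum A ∧
    ∀ r : ℕ, 1 ≤ r → r < s → J.component r x = 0}

end RealJordanDecomposition

end Jordan

end

/-! In a basis made of Jordan chains, `A = S + N`, where `N` is the shift along the chains, `S` is
skew-adjoint for the inner product that makes the basis orthonormal, and `S` and `N` commute. The
sum of the real eigenspaces is `ker N` (`JordanBasis.eigenSum_eq_ker`), and `exp (tA) = exp (tS) exp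
(tN)`.

The factor `exp (tS)` is bounded for all times, and `exp (tN) y` is a polynomial in `t` with leading
term `(t ^ k / k!) N ^ k y`, where `N ^ k y` is the last nonzero iterate. Hence the line through `y`
is asymptotic to the line through `N ^ k y`, which lies in `ker N` (`tendsto_dist_projFlow`). On
`ker N` the flow is `exp (tS)`, and along one sequence of times tending to infinity `exp (tS)` tends
to the identity. So all lines in `ker N` are recurrent, and two different ones are never asymptotic
(`mk_eq_mk_of_tendsto_dist`).

A point of the stratum `s` is the line of some `x` in `ker N` that lies in the range of `N ^ (s -
1)` but not in that of `N ^ s`. With `x = N ^ (s - 1) y₀`, its stable manifold is contained in the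
projective space of `ℝ y₀ + ker (N ^ (s - 1))` (`exists_sub_smul_mem_ker`) and contains all lines
through points of `y₀ + ker (N ^ (s - 1))` (`mk_mem_stableManifold`). Its dimension is therefore
`dim ker (N ^ (s - 1))`, and counting basis vectors chain by chain turns this number into the stated
formula.

The topological dimension is the small inductive one. The upper bound holds because small metric
spheres in spheres and projective spaces lie in copies of lower-dimensional spheres. For the lower
bound, a compact space of dimension less than `n` admits extensions of nonvanishing `ℝⁿ`-valued maps
from closed subsets. For a ball in `ℝⁿ` this would give a retraction onto the boundary sphere, which
an integral argument excludes. -/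

open scoped TensorProduct

noncomputable section

/-! ### Subspaces and small inductive dimension -/

section SmallInductiveDimension

universe u v w

/-- The frontier of a preimage lies in the preimage of the frontier, so a basis with small frontiers
pulls back to one. Inducing maps, rather than subsets, keep the induction free of nested subtypes.
-/
theorem HasSmallInductiveDimensionLT.of_isInducing {n : ℕ} :
    ∀ {X : Type u} {Y : Type v} [TopologicalSpace X] [TopologicalSpace Y] {f : Y → X},
      IsInducing f → HasSmallInductiveDimensionLT X n → HasSmallInductiveDimensionLT Y n := by
  induction n with
  | zero =>
    intro X Y _ _ f hf h
    rw [hasSmallInductiveDimensionLT_zero_iff] at h ⊢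
    exact f.isEmpty
  | succ n ih =>
    intro X Y _ _ f hf h
    cases h with
    | succ _ s hs h =>
    refine .succ n _ (hs.isInducing hf) ?_
    rintro _ ⟨U, hU, rfl⟩
    have hsub : frontier (f ⁻¹' U) ⊆ f ⁻¹' frontier U :=
      hf.continuous.frontier_preimage_subset U
    have hg : IsInducing (fun y : frontier (f ⁻¹' U) => (⟨f y, hsub y.2⟩ : frontier U)) := by
      refine IsInducing.of_comp (g := Subtype.val) ?_ continuous_subtype_val
        (hf.comp IsInducing.subtypeVal)
      exact (hf.continuous.comp continuous_subtype_val).subtype_mk _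
    exact ih hg (h U hU)

/-- A continuous injection from a compact space to a Hausdorff space is an embedding, so `Y` is
homeomorphic to a subspace of `K`. -/
theorem HasSmallInductiveDimensionLT.of_range_subset {n : ℕ} {K : Type u} {X : Type v}
    [TopologicalSpace K] [CompactSpace K] [TopologicalSpace X] [T2Space X] {g : K → X}
    (hg : Continuous g) (hinj : Function.Injective g) (hK : HasSmallInductiveDimensionLT K n)
    {Y : Type w} [TopologicalSpace Y] {f : Y → X} (hf : IsInducing f)
    (hfg : ∀ y, f y ∈ Set.range g) : HasSmallInductiveDimensionLT Y n := by
  have he := (hg.isClosedEmbedding hinj).isEmbedding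
  have h1 : IsInducing (fun y : Y => (⟨f y, hfg y⟩ : Set.range g)) :=
    IsInducing.of_comp (g := Subtype.val) (hf.continuous.subtype_mk _) continuous_subtype_val hf
  exact .of_isInducing (he.toHomeomorph.symm.isInducing.comp h1) hK

theorem HasSmallInductiveDimensionLT.succ_of_nhds {n : ℕ} {X : Type u} [TopologicalSpace X]
    (h : ∀ x : X, ∀ O : Set X, x ∈ O → IsOpen O → ∃ U : Set X, IsOpen U ∧ x ∈ U ∧ U ⊆ O ∧
      HasSmallInductiveDimensionLT (frontier U) n) :
    HasSmallInductiveDimensionLT X (n + 1) := by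
  refine .succ n {U | IsOpen U ∧ HasSmallInductiveDimensionLT (frontier U) n} ?_ fun U hU => hU.2
  refine TopologicalSpace.isTopologicalBasis_of_isOpen_of_nhds (fun U hU => hU.1) ?_
  intro x O hx hO
  obtain ⟨U, h1, h2, h3, h4⟩ := h x O hx hO
  exact ⟨U, ⟨h1, h4⟩, h2, h3⟩

end SmallInductiveDimension

/-! ### Extension of nonvanishing maps -/

section Nonvanishing

universe u v

variable {X : Type u} [TopologicalSpace X]

theorem exists_continuousMap_eqOn {Y : Type v} [TopologicalSpace Y] [TietzeExtension.{u, v} Y]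
    [NormalSpace X] {A : Set X} (hA : IsClosed A) {f : X → Y} (hf : ContinuousOn f A) :
    ∃ g : C(X, Y), Set.EqOn g f A := by
  obtain ⟨g, hg⟩ := ContinuousMap.exists_restrict_eq hA ⟨A.domRestrict f, hf.domRestrict⟩
  exact ⟨g, fun a ha => congrArg (fun φ : C(A, Y) => φ ⟨a, ha⟩) hg⟩

theorem exists_continuousMap_pos_eqOn [NormalSpace X] {A : Set X} (hA : IsClosed A) {f : X → ℝ}
    (hf : ContinuousOn f A) (hpos : ∀ a ∈ A, 0 < f a) :
    ∃ g : C(X, ℝ), Set.EqOn g f A ∧ ∀ x, 0 < g x := by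
  obtain ⟨g, hg0, hg⟩ := ContinuousMap.exists_restrict_eq_forall_mem_of_closed
    (⟨A.domRestrict f, hf.domRestrict⟩ : C(A, ℝ)) (t := Set.Ioi 0) (fun a => hpos a a.2)
    ⟨1, Set.mem_Ioi.2 one_pos⟩ hA
  exact ⟨g, fun a ha => congrArg (fun φ : C(A, ℝ) => φ ⟨a, ha⟩) hg, hg0⟩

theorem Set.piecewise_continuousOn_union {Y : Type*} [TopologicalSpace Y] {s t : Set X}
    [∀ x, Decidable (x ∈ s)] (hs : IsClosed s) (ht : IsClosed t) {f g : X → Y}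
    (hf : ContinuousOn f s) (hg : ContinuousOn g t) (h : Set.EqOn f g (s ∩ t)) :
    ContinuousOn (s.piecewise f g) (s ∪ t) ∧ Set.EqOn (s.piecewise f g) g t := by
  have h2 : Set.EqOn (s.piecewise f g) g t := by
    intro x hx
    by_cases hxs : x ∈ s
    · rw [Set.piecewise_eq_of_mem _ _ _ hxs]; exact h ⟨hxs, hx⟩
    · rw [Set.piecewise_eq_of_notMem _ _ _ hxs]
  refine ⟨ContinuousOn.union_of_isClosed (hf.congr (Set.piecewise_eqOn s f g)) (hg.congr h2)
    hs ht, h2⟩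

/-- Every nonvanishing map from a closed subset of `Y` to `ℝⁿ` extends to a nonvanishing map
on `Y`. -/
def NonvanishingExtension (n : ℕ) (Y : Set X) : Prop :=
  ∀ A ⊆ Y, IsClosed A → ∀ f : X → Fin n → ℝ, ContinuousOn f A → (∀ a ∈ A, f a ≠ 0) →
    ∃ F : X → Fin n → ℝ, ContinuousOn F Y ∧ (∀ y ∈ Y, F y ≠ 0) ∧ Set.EqOn F f A

theorem NonvanishingExtension.mono {n : ℕ} {Y Z : Set X} (h : NonvanishingExtension n Y)
    (hZ : Z ⊆ Y) : NonvanishingExtension n Z := by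
  intro A hA hAc f hf h0
  obtain ⟨F, h1, h2, h3⟩ := h A (hA.trans hZ) hAc f hf h0
  exact ⟨F, h1.mono hZ, fun y hy => h2 y (hZ hy), h3⟩

open Classical in
-- Extend over `Y` first, then from `A ∪ Y` over `Z`. This passage to finite closed unions takes the
-- place of a sum theorem for the dimension.
theorem NonvanishingExtension.union {n : ℕ} {Y Z : Set X} (hY : NonvanishingExtension n Y)
    (hZ : NonvanishingExtension n Z) (hYc : IsClosed Y) (hZc : IsClosed Z) :
    NonvanishingExtension n (Y ∪ Z) := by
  intro A hA hAc f hf h0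
  obtain ⟨F, h1, h2, h3⟩ := hY (A ∩ Y) Set.inter_subset_right (hAc.inter hYc) f
    (hf.mono Set.inter_subset_left) fun a ha => h0 a ha.1
  obtain ⟨hc, he⟩ := Set.piecewise_continuousOn_union hAc hYc hf h1 fun a ha => (h3 ha).symm
  have hne : ∀ a ∈ A ∪ Y, A.piecewise f F a ≠ 0 := by
    rintro a (ha | ha)
    · rw [Set.piecewise_eq_of_mem _ _ _ ha]; exact h0 a ha
    · rw [he ha]; exact h2 a ha
  obtain ⟨G, g1, g2, g3⟩ := hZ ((A ∪ Y) ∩ Z) Set.inter_subset_right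
    ((hAc.union hYc).inter hZc) (A.piecewise f F) (hc.mono Set.inter_subset_left)
    fun a ha => hne a ha.1
  obtain ⟨hc', he'⟩ := Set.piecewise_continuousOn_union (hAc.union hYc) hZc hc g1
    fun a ha => (g3 ha).symm
  refine ⟨_, hc'.mono ?_, ?_, ?_⟩
  · exact Set.union_subset_union_left _ Set.subset_union_right
  · rintro y (hy | hy)
    · rw [Set.piecewise_eq_of_mem _ _ _ (show y ∈ A ∪ Y from Or.inr hy)]; exact hne y (Or.inr hy)
    · rw [he' hy]; exact g2 y hy
  · intro a ha
    rw [Set.piecewise_eq_of_mem _ _ _ (show a ∈ A ∪ Y from Or.inl ha), Set.piecewise_eq_of_mem _ _ _ ha]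

theorem nonvanishingExtension_empty (n : ℕ) : NonvanishingExtension n (∅ : Set X) :=
  fun _ _ _ f _ _ => ⟨f, continuousOn_empty _, fun _ h => h.elim, fun _ _ => rfl⟩

theorem nonvanishingExtension_biUnion {n : ℕ} (t : Finset (Set X)) (φ : Set X → Set X)
    (hc : ∀ s ∈ t, IsClosed (φ s)) (h : ∀ s ∈ t, NonvanishingExtension n (φ s)) :
    NonvanishingExtension n (⋃ s ∈ t, φ s) := by
  classical
  induction t using Finset.induction_on with
  | empty => simpa using nonvanishingExtension_empty n
  | insert a t ha ih =>
    rw [Finset.set_biUnion_insert]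
    refine (h a (Finset.mem_insert_self _ _)).union
      (ih (fun s hs => hc s (Finset.mem_insert_of_mem hs))
        fun s hs => h s (Finset.mem_insert_of_mem hs)) (hc a (Finset.mem_insert_self _ _)) ?_
    exact t.finite_toSet.isClosed_biUnion fun s hs => hc s (Finset.mem_insert_of_mem hs)

open Classical in
theorem NonvanishingExtension.of_subtype {n : ℕ} {Y : Set X}
    (h : NonvanishingExtension n (Set.univ : Set Y)) : NonvanishingExtension n Y := by
  intro A hA hAc f hf h0
  obtain ⟨F, h1, h2, h3⟩ := h (Subtype.val ⁻¹' A) (Set.subset_univ _)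
    (hAc.preimage continuous_subtype_val) (fun y => f y)
    (hf.comp continuous_subtype_val.continuousOn fun y hy => hy) fun a ha => h0 a ha
  have hr : ∀ y (hy : y ∈ Y), (fun x => if hx : x ∈ Y then F ⟨x, hx⟩ else 0) y = F ⟨y, hy⟩ :=
    fun y hy => dif_pos hy
  refine ⟨fun x => if hx : x ∈ Y then F ⟨x, hx⟩ else 0, ?_, ?_, ?_⟩
  · rw [continuousOn_iff_continuous_domRestrict]
    convert! continuousOn_univ.1 h1 using 1
    ext1 y
    exact hr y y.2
  · intro y hy
    rw [hr y hy]
    exact h2 _ trivial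
  · intro a ha
    rw [hr a (hA ha)]
    exact h3 (x := ⟨a, hA ha⟩) ha

open Classical in
-- Split `f` into its first coordinate and its tail. On the zero set of the tail the first
-- coordinate has no zeros, so its signs give two disjoint closed sets, separated by `P` and `Q`.
-- Off `P ∪ Q` the tail extends without zeros by the property in dimension `n`. Any further
-- extension `G` of the tail vanishes only inside `P ∪ Q`, and there the first coordinate can be
-- chosen positive on `P` and negative on `Q`.
theorem nonvanishingExtension_succ [NormalSpace X] {n : ℕ}
    (h : ∀ C D : Set X, IsClosed C → IsClosed D → Disjoint C D → ∃ P Q : Set X, IsOpen P ∧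
      IsOpen Q ∧ Disjoint P Q ∧ C ⊆ P ∧ D ⊆ Q ∧ NonvanishingExtension n (P ∪ Q)ᶜ) :
    NonvanishingExtension (n + 1) (Set.univ : Set X) := by
  intro A _ hAc f hf h0
  have hf0 : ContinuousOn (fun x => f x 0) A := (continuous_apply 0).comp_continuousOn hf
  have hft : ContinuousOn (fun x => Fin.tail (f x)) A :=
    continuousOn_pi.2 fun i => (continuous_apply i.succ).comp_continuousOn hf
  have hft0 : ∀ a ∈ A, Fin.tail (f a) = 0 → f a 0 ≠ 0 := by
    intro a ha h1 h2
    refine h0 a ha (funext fun i => ?_)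
    refine Fin.cases h2 (fun j => congrFun h1 j) i
  have hzc : IsClosed (A ∩ {x | Fin.tail (f x) = 0}) := by
    convert! hft.preimage_isClosed_of_isClosed hAc isClosed_singleton (t := {0}) using 1
  have hzc' : ∀ s : Set ℝ, IsClosed s → IsClosed (A ∩ {x | Fin.tail (f x) = 0} ∩ {x | f x 0 ∈ s}) :=
    fun s hs => (hf0.mono Set.inter_subset_left).preimage_isClosed_of_isClosed hzc hs
  obtain ⟨P, Q, hP, hQ, hPQ, hCP, hDQ, hL⟩ := h _ _ (hzc' (Set.Ici 0) isClosed_Ici)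
    (hzc' (Set.Iic 0) isClosed_Iic) (by
      rw [Set.disjoint_left]
      rintro x ⟨⟨hxA, hx⟩, h1⟩ ⟨-, h2⟩
      exact hft0 x hxA hx (le_antisymm h2 h1))
  have hLc : IsClosed (P ∪ Q)ᶜ := (hP.union hQ).isClosed_compl
  have hdi : ∀ x, x ∈ P → x ∈ Q → False := fun x h1 h2 => Set.disjoint_left.1 hPQ h1 h2
  obtain ⟨G₁, hG₁, hG₁0, hG₁e⟩ := hL (A ∩ (P ∪ Q)ᶜ) Set.inter_subset_right (hAc.inter hLc) _
    (hft.mono Set.inter_subset_left) (by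
      rintro a ⟨ha, haL⟩ h1
      rcases le_total 0 (f a 0) with h2 | h2
      · exact haL (Or.inl (hCP ⟨⟨ha, h1⟩, h2⟩))
      · exact haL (Or.inr (hDQ ⟨⟨ha, h1⟩, h2⟩)))
  obtain ⟨hc, he⟩ := Set.piecewise_continuousOn_union hAc hLc hft hG₁ fun a ha => (hG₁e ha).symm
  obtain ⟨G, hG⟩ := exists_continuousMap_eqOn (hAc.union hLc) hc
  have hGA : ∀ a ∈ A, G a = Fin.tail (f a) := fun a ha => by
    rw [hG (Or.inl ha), Set.piecewise_eq_of_mem _ _ _ ha]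
  have hGL : ∀ x, G x = 0 → x ∈ P ∪ Q := by
    intro x hx
    by_contra hxL
    exact hG₁0 x hxL (by rw [← he hxL, ← hG (Or.inr hxL), hx])
  have hZc : IsClosed {x | G x = 0} := isClosed_singleton.preimage G.continuous
  -- The zeros of `G` lie in the disjoint union of `P` and `Q`, so removing `Q` leaves those in `P`,
  -- in a form that is visibly closed.
  have hZP : IsClosed ({x | G x = 0} ∩ Qᶜ) := hZc.inter hQ.isClosed_compl
  have hZQ : IsClosed ({x | G x = 0} ∩ Pᶜ) := hZc.inter hP.isClosed_compl
  have hposA : ∀ a ∈ A ∩ ({x | G x = 0} ∩ Qᶜ), 0 < f a 0 := by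
    rintro a ⟨ha, hz, hq⟩
    have hz' : Fin.tail (f a) = 0 := by rw [← hGA a ha]; exact hz
    by_contra hn
    exact hq (hDQ ⟨⟨ha, hz'⟩, not_lt.1 hn⟩)
  have hnegA : ∀ a ∈ A ∩ ({x | G x = 0} ∩ Pᶜ), 0 < -f a 0 := by
    rintro a ⟨ha, hz, hq⟩
    have hz' : Fin.tail (f a) = 0 := by rw [← hGA a ha]; exact hz
    by_contra hn
    exact hq (hCP ⟨⟨ha, hz'⟩, show 0 ≤ f a 0 by linarith⟩)
  obtain ⟨H₁, hH₁e, hH₁⟩ := exists_continuousMap_pos_eqOn (hAc.inter hZP)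
    (hf0.mono Set.inter_subset_left) hposA
  obtain ⟨H₂, hH₂e, hH₂⟩ := exists_continuousMap_pos_eqOn (hAc.inter hZQ)
    (hf0.neg.mono Set.inter_subset_left) hnegA
  obtain ⟨hc1, he1⟩ := Set.piecewise_continuousOn_union hAc hZP hf0 H₁.continuous.continuousOn
    fun a ha => (hH₁e ha).symm
  obtain ⟨hc2, he2⟩ := Set.piecewise_continuousOn_union (hAc.union hZP) hZQ hc1
    (g := fun x => -H₂ x) H₂.continuous.neg.continuousOn (by
      rintro a ⟨ha | ha, ha'⟩
      · have h1 : H₂ a = -f a 0 := hH₂e ⟨ha, ha'⟩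
        simp only [Set.piecewise_eq_of_mem _ _ _ ha, h1, neg_neg]
      · rcases hGL a ha'.1 with h1 | h1
        · exact (ha'.2 h1).elim
        · exact (ha.2 h1).elim)
  obtain ⟨H, hH⟩ := exists_continuousMap_eqOn ((hAc.union hZP).union hZQ) hc2
  refine ⟨fun x => Fin.cons (H x) (G x), ?_, ?_, ?_⟩
  · refine continuousOn_univ.2 (continuous_pi fun i => ?_)
    refine Fin.cases ?_ (fun j => ?_) i
    · simpa using H.continuous
    · simpa using continuous_pi_iff.1 G.continuous j
  · intro x _ hx
    have hx0 : H x = 0 := by simpa using congrFun hx 0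
    have hxG : G x = 0 := funext fun j => by simpa using congrFun hx j.succ
    rcases hGL x hxG with h1 | h1
    · have h2 : x ∈ {x | G x = 0} ∩ Qᶜ := ⟨hxG, fun h3 => hdi x h1 h3⟩
      rw [hH (Or.inl (Or.inr h2)), Set.piecewise_eq_of_mem _ _ _
        (show x ∈ A ∪ ({x | G x = 0} ∩ Qᶜ) from Or.inr h2), he1 h2] at hx0
      exact (hH₁ x).ne' hx0
    · have h2 : x ∈ {x | G x = 0} ∩ Pᶜ := ⟨hxG, fun h3 => hdi x h3 h1⟩
      rw [hH (Or.inr h2), he2 h2, neg_eq_zero] at hx0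
      exact (hH₂ x).ne' hx0
  · intro a ha
    funext i
    refine Fin.cases ?_ (fun j => ?_) i
    · simp only [Fin.cons_zero]
      rw [hH (Or.inl (Or.inl ha)), Set.piecewise_eq_of_mem _ _ _
        (show a ∈ A ∪ ({x | G x = 0} ∩ Qᶜ) from Or.inl ha), Set.piecewise_eq_of_mem _ _ _ ha]
    · simp only [Fin.cons_succ]
      rw [hGA a ha]
      rfl

/-- By compactness, finitely many basic open sets with closures off `D` cover `C`. Their union is
separated from `D` by its frontier, which lies in the finite union of their frontiers, and these
have smaller dimension. -/
theorem HasSmallInductiveDimensionLT.nonvanishingExtension {n : ℕ} :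
    ∀ {X : Type u} [TopologicalSpace X] [CompactSpace X] [T2Space X],
      HasSmallInductiveDimensionLT X n → NonvanishingExtension n (Set.univ : Set X) := by
  induction n with
  | zero =>
    intro X _ _ _ h
    rw [hasSmallInductiveDimensionLT_zero_iff] at h
    rw [Set.univ_eq_empty_iff.2 h]
    exact nonvanishingExtension_empty 0
  | succ n ih =>
    intro X _ _ _ h
    cases h with
    | succ _ s hs h =>
    refine nonvanishingExtension_succ fun C D hC hD hCD => ?_
    have hcov : ∀ x ∈ C, ∃ U ∈ s, x ∈ U ∧ closure U ⊆ Dᶜ := by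
      intro x hx
      obtain ⟨V, hVs, hxV, hVD⟩ := hs.exists_closure_subset
        (hD.isOpen_compl.mem_nhds (Set.disjoint_left.1 hCD hx))
      exact ⟨V, hVs, hxV, hVD⟩
    choose! U hUs hxU hUD using hcov
    obtain ⟨t, htC, ht⟩ := hC.isCompact.elim_nhds_subcover U
      fun x hx => (hs.isOpen (hUs x hx)).mem_nhds (hxU x hx)
    classical
    have hT : ∀ V ∈ t.image U, V ∈ s ∧ closure V ⊆ Dᶜ := by
      intro V hV
      obtain ⟨x, hx, rfl⟩ := Finset.mem_image.1 hV
      exact ⟨hUs x (htC x hx), hUD x (htC x hx)⟩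
    have hPe : (⋃ V ∈ t.image U, V) = ⋃ x ∈ t, U x := by simp
    have hcl : closure (⋃ V ∈ t.image U, V) = ⋃ V ∈ t.image U, closure V :=
      (t.image U).finite_toSet.closure_biUnion (fun V => V)
    have hPo : IsOpen (⋃ V ∈ t.image U, V) :=
      isOpen_biUnion fun V hV => hs.isOpen (hT V hV).1
    -- With `Q` the complement of the closure of `P`, the set that remains is exactly the frontier
    -- of `P`.
    refine ⟨⋃ V ∈ t.image U, V, (closure (⋃ V ∈ t.image U, V))ᶜ, hPo,
      isClosed_closure.isOpen_compl, ?_, hPe ▸ ht, ?_, ?_⟩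
    · exact disjoint_compl_right.mono_left subset_closure
    · rw [Set.subset_compl_comm, hcl]
      exact Set.iUnion₂_subset fun V hV => (hT V hV).2
    · refine (nonvanishingExtension_biUnion (t.image U) frontier (fun V _ => isClosed_frontier)
        fun V hV => ?_).mono ?_
      · have : CompactSpace (frontier V) := isCompact_iff_compactSpace.1
          isClosed_frontier.isCompact
        exact .of_subtype (ih (h V (hT V hV).1))
      · intro x hx
        rw [Set.compl_union, compl_compl, hcl] at hx
        obtain ⟨hx1, hx2⟩ := hx
        obtain ⟨V, hV, hxV⟩ := Set.mem_iUnion₂.1 hx2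
        refine Set.mem_iUnion₂.2 ⟨V, hV, ?_⟩
        rw [(hs.isOpen (hT V hV).1).frontier_eq]
        exact ⟨hxV, fun h1 => hx1 (Set.mem_iUnion₂.2 ⟨V, hV, h1⟩)⟩

end Nonvanishing

/-! ### There is no retraction of a ball onto its boundary sphere -/

section NoRetraction

open MeasureTheory

/-- If a continuous function `p` on a bounded set depends polynomially on a parameter, and its
integral is constant for small parameters, then the integral is constant. -/
theorem integral_eq_of_polynomial {α : Type*} [MeasurableSpace α] {μ : Measure α} (m : ℕ)
    (q : ℝ → α → ℝ) (hq : ∀ x, ∃ p : Polynomial ℝ, p.natDegree ≤ m ∧ ∀ t, q t x = p.eval t)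
    (hint : ∀ t, Integrable (q t) μ) {c δ : ℝ} (hδ : 0 < δ)
    (hc : ∀ t, 0 < t → t < δ → ∫ x, q t x ∂μ = c) (T : ℝ) : ∫ x, q T x ∂μ = c := by
  -- These `m + 1` distinct nodes lie in `(0, δ)`; the summand `2` keeps the node at `j = 0`
  -- strictly below `δ`. Lagrange interpolation expresses the value at `T` through them with weights
  -- independent of `x` and of sum `1`, so the identity can be integrated directly.
  let v : ℕ → ℝ := fun j => δ / (j + 2)
  have hv : Set.InjOn v (Finset.range (m + 1)) := by
    intro i _ j _ hij
    have hi : ((i : ℝ) + 2) ≠ 0 := by positivity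
    have hj : ((j : ℝ) + 2) ≠ 0 := by positivity
    have : δ / ((i : ℝ) + 2) = δ / (j + 2) := hij
    rw [div_eq_div_iff hi hj, mul_right_inj' hδ.ne'] at this
    exact_mod_cast (add_right_cancel this).symm
  let w : ℕ → ℝ := fun j => (Lagrange.basis (Finset.range (m + 1)) v j).eval T
  have hw : ∑ j ∈ Finset.range (m + 1), w j = 1 := by
    have := congrArg (Polynomial.eval T) (Lagrange.sum_basis hv ⟨0, by simp⟩)
    rwa [Polynomial.eval_finsetSum, Polynomial.eval_one] at this
  have hqT : ∀ x, q T x = ∑ j ∈ Finset.range (m + 1), w j * q (v j) x := by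
    intro x
    obtain ⟨p, hp, hpq⟩ := hq x
    have hdeg : p.degree < (Finset.range (m + 1)).card := by
      rw [Finset.card_range]
      exact lt_of_le_of_lt Polynomial.degree_le_natDegree (by exact_mod_cast Nat.lt_succ_of_le hp)
    have h1 := congrArg (Polynomial.eval T) (Lagrange.eq_interpolate hv hdeg)
    rw [Lagrange.interpolate_apply, Polynomial.eval_finsetSum] at h1
    rw [hpq, h1]
    refine Finset.sum_congr rfl fun j _ => ?_
    rw [Polynomial.eval_mul, Polynomial.eval_C, hpq, mul_comm]
  have h2 : ∀ j, ∫ x, w j * q (v j) x ∂μ = w j * c := by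
    intro j
    rw [integral_const_mul, hc (v j) (by positivity)]
    have : (0 : ℝ) ≤ j := j.cast_nonneg
    exact div_lt_self hδ (by linarith)
  simp_rw [hqT]
  rw [integral_finsetSum _ fun j _ => (hint (v j)).const_mul (w j)]
  simp_rw [h2]
  rw [← Finset.sum_mul, hw, one_mul]

theorem exists_polynomial_det {E : Type*} [NormedAddCommGroup E] [NormedSpace ℝ E]
    [FiniteDimensional ℝ E] (L : E →L[ℝ] E) :
    ∃ p : Polynomial ℝ, p.natDegree ≤ finrank ℝ E ∧
      ∀ t : ℝ, (1 + t • L : E →L[ℝ] E).det = p.eval t := by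
  let b := Module.finBasis ℝ E
  let M := LinearMap.toMatrix b b (L : E →ₗ[ℝ] E)
  refine ⟨Matrix.det ((Polynomial.X : Polynomial ℝ) • M.map Polynomial.C
    + (1 : Matrix _ _ ℝ).map Polynomial.C), ?_, fun t => ?_⟩
  · simpa using Polynomial.natDegree_det_X_add_C_le M 1
  · rw [← Polynomial.coe_evalRingHom, RingHom.map_det, ContinuousLinearMap.det,
      ← LinearMap.det_toMatrix b]
    congr 1
    have : ((1 + t • L : E →L[ℝ] E) : E →ₗ[ℝ] E) = 1 + t • (L : E →ₗ[ℝ] E) := rfl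
    rw [this, map_add, map_smul, LinearMap.toMatrix_one]
    ext i j
    simp only [Matrix.add_apply, Matrix.smul_apply, RingHom.mapMatrix_apply, Matrix.map_apply,
      Polynomial.coe_evalRingHom, Polynomial.eval_add, smul_eq_mul, Polynomial.eval_mul,
      Polynomial.eval_X, Polynomial.eval_C]
    rw [add_comm]

/-- The determinant is `1` at time `0`. Were it not positive at `t`, it would vanish at some `s ≤
t`, and a kernel vector `v = -s L v` contradicts `s ‖L‖ < 1`. -/
theorem det_one_add_pos {E : Type*} [NormedAddCommGroup E] [NormedSpace ℝ E]
    [FiniteDimensional ℝ E] (L : E →L[ℝ] E) {t K : ℝ} (ht : 0 ≤ t) (hL : ‖L‖ ≤ K)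
    (htK : t * K < 1) : 0 < (1 + t • L : E →L[ℝ] E).det := by
  obtain ⟨p, -, hp⟩ := exists_polynomial_det L
  rw [hp]
  by_contra hn
  have h0 : p.eval 0 = 1 := by
    rw [← hp, zero_smul, add_zero]
    exact LinearMap.det_id
  have hmem : (0 : ℝ) ∈ Set.Icc (p.eval t) (p.eval 0) := ⟨not_lt.1 hn, by rw [h0]; exact zero_le_one⟩
  obtain ⟨s, ⟨hs0, hst⟩, hs⟩ := intermediate_value_Icc' ht p.continuous.continuousOn hmem
  have hs' : LinearMap.det ((1 + s • L : E →L[ℝ] E) : E →ₗ[ℝ] E) = 0 :=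
    (hp s).trans hs
  obtain ⟨v, hv, hv0⟩ := Submodule.ne_bot_iff _ |>.1
    (LinearMap.bot_lt_ker_of_det_eq_zero hs').ne'
  have h1 : v = -(s • L v) := by
    rw [eq_neg_iff_add_eq_zero]
    exact hv
  have h2 : ‖v‖ ≤ s * K * ‖v‖ := by
    calc ‖v‖ = s * ‖L v‖ := by
          conv_lhs => rw [h1, norm_neg, norm_smul, Real.norm_of_nonneg hs0]
      _ ≤ s * (K * ‖v‖) := by
          gcongr
          exact (L.le_opNorm v).trans (by gcongr)
      _ = _ := by ring
  have hK : 0 ≤ K := (norm_nonneg _).trans hL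
  have h3 : s * K < 1 := lt_of_le_of_lt (by gcongr) htK
  have h4 : 0 < ‖v‖ := norm_pos_iff.2 hv0
  nlinarith

variable {E : Type*} [NormedAddCommGroup E] [NormedSpace ℝ E]

/-- A preimage of `y` is a fixed point of the contraction `x ↦ y - t • h x`. -/
theorem bijective_id_add_smul [CompleteSpace E] {h : E → E} {K : NNReal} (hh : LipschitzWith K h)
    {t : ℝ} (ht : 0 ≤ t) (htK : t * K < 1) : Function.Bijective fun x => x + t • h x := by
  have hΦ : ∀ y x x', ‖(y - t • h x) - (y - t • h x')‖ ≤ t * K * ‖x - x'‖ := by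
    intro y x x'
    rw [sub_sub_sub_cancel_left, ← smul_sub, norm_smul, Real.norm_of_nonneg ht, mul_assoc,
      ← norm_neg (x - x'), neg_sub]
    gcongr
    exact hh.norm_sub_le _ _
  constructor
  · intro x x' hxx
    have h1 : x + t • h x = x' + t • h x' := hxx
    have h2 := hΦ (x + t • h x) x x'
    rw [add_sub_cancel_right, h1, add_sub_cancel_right] at h2
    by_contra hne
    have : 0 < ‖x - x'‖ := norm_pos_iff.2 (sub_ne_zero.2 hne)
    nlinarith
  · intro y
    have hc : ContractingWith ⟨t * K, by positivity⟩ fun x => y - t • h x := by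
      refine ⟨by exact_mod_cast htK, LipschitzWith.of_dist_le_mul fun x x' => ?_⟩
      rw [dist_eq_norm, dist_eq_norm]
      exact hΦ y x x'
    refine ⟨hc.fixedPoint, ?_⟩
    have := hc.fixedPoint_isFixedPt
    exact (eq_sub_iff_add_eq.1 this.eq.symm)

theorem exists_mem_segment_norm_eq {x y : E} (hx : ‖x‖ ≤ 1) (hy : 1 ≤ ‖y‖) :
    ∃ z ∈ segment ℝ x y, ‖z‖ = 1 := by
  have := (convex_segment (𝕜 := ℝ) x y).isPreconnected.intermediate_value
    (left_mem_segment ℝ x y) (right_mem_segment ℝ x y) continuous_norm.continuousOn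
  exact this ⟨hx, hy⟩

open Classical in
-- A segment from inside to outside crosses the unit sphere, where `h` vanishes; comparing with the
-- crossing point preserves the constant.
theorem lipschitzWith_extend_zero {h : E → E} {K : NNReal}
    (hh : LipschitzOnWith K h (Metric.closedBall 0 1)) (h0 : ∀ x, ‖x‖ = 1 → h x = 0) :
    LipschitzWith K fun x => if ‖x‖ ≤ 1 then h x else 0 := by
  have key : ∀ x y : E, ‖x‖ ≤ 1 → 1 ≤ ‖y‖ → dist (h x) 0 ≤ K * dist x y := by
    intro x y hx hy
    obtain ⟨z, hz, hz1⟩ := exists_mem_segment_norm_eq hx hy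
    have h1 := hh.dist_le_mul x (by simpa using hx) z (by simpa using hz1.le)
    rw [h0 z hz1] at h1
    refine h1.trans ?_
    gcongr
    have := dist_add_dist_of_mem_segment hz
    linarith [dist_nonneg (x := z) (y := y)]
  refine LipschitzWith.of_dist_le_mul fun x y => ?_
  have hK : (0 : ℝ) ≤ K * dist x y := by positivity
  split_ifs with hx hy hy
  · exact hh.dist_le_mul x (by simpa using hx) y (by simpa using hy)
  · exact key x y hx (not_le.1 hy).le
  · rw [dist_comm, dist_comm x y]
    exact key y x hy (not_le.1 hx).le
  · simpa using hK

/-- Let `h = r - id`, cut off to zero outside the unit ball. For small `t` the map `x + t h(x)` is a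
bijection fixing everything outside the open ball, so it maps the ball onto itself, and the integral
of `det (1 + t Dh)` over the ball is the volume of the ball. This integral is polynomial in `t`,
hence constant, yet at `t = 1` the integrand is `det Dr = 0`. -/
theorem not_exists_contDiff_retraction [FiniteDimensional ℝ E] [MeasurableSpace E]
    [BorelSpace E] {r : E → E} (hr : ContDiff ℝ 1 r) (hr1 : ∀ x, ‖x‖ = 1 → r x = x)
    (hdet : ∀ x, (fderiv ℝ r x).det = 0) : False := by
  classical
  have : CompleteSpace E := FiniteDimensional.complete ℝ E
  let μ : Measure E := Measure.addHaar
  let h : E → E := fun x => r x - x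
  have hh : ContDiff ℝ 1 h := hr.sub contDiff_id
  obtain ⟨K, hK⟩ := hh.contDiffOn.exists_lipschitzOnWith (s := Metric.closedBall (0 : E) 1) one_ne_zero
    (convex_closedBall 0 1) (isCompact_closedBall 0 1)
  have hlip := lipschitzWith_extend_zero hK fun x hx => sub_eq_zero.2 (hr1 x hx)
  set g : E → E := fun x => if ‖x‖ ≤ 1 then h x else 0 with hg
  have hgball : ∀ x ∈ Metric.ball (0 : E) 1, g x = h x := fun x hx =>
    if_pos (mem_ball_zero_iff.1 hx).le
  have hgout : ∀ x, 1 ≤ ‖x‖ → g x = 0 := by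
    intro x hx
    rcases hx.eq_or_lt with h1 | h1
    · rw [hg]; simp only [h1.symm.le, if_true]; exact sub_eq_zero.2 (hr1 x h1.symm)
    · exact if_neg (not_le.2 h1)
  have hdiff : ∀ x, HasFDerivAt h (fderiv ℝ h x) x := fun x =>
    (hh.differentiable one_ne_zero x).hasFDerivAt
  have hcont : ∀ t : ℝ, Continuous fun x => (1 + t • fderiv ℝ h x : E →L[ℝ] E).det := fun t =>
    ContinuousLinearMap.continuous_det.comp
      (continuous_const.add ((hh.continuous_fderiv one_ne_zero).const_smul t))
  -- The bound `1 / (K + 1)` ensures `t * K < 1` without a separate case `K = 0`.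
  have hsmall : ∀ t : ℝ, 0 < t → t < 1 / (K + 1) →
      ∫ x in Metric.ball (0 : E) 1, (1 + t • fderiv ℝ h x : E →L[ℝ] E).det ∂μ =
        μ.real (Metric.ball 0 1) := by
    intro t ht htK
    have htK' : t * K < 1 := by
      rw [lt_div_iff₀ (by positivity)] at htK
      nlinarith
    have hbij := bijective_id_add_smul hlip ht.le htK'
    have hout : ∀ x : E, 1 ≤ ‖x‖ → x + t • g x = x := fun x hx => by
      rw [hgout x hx, smul_zero, add_zero]
    have himage : (fun x => x + t • g x) '' Metric.ball 0 1 = Metric.ball 0 1 := by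
      ext y
      rw [mem_ball_zero_iff]
      constructor
      · rintro ⟨x, hx, rfl⟩
        rw [mem_ball_zero_iff] at hx
        by_contra hn
        have h1 := hbij.1 (hout _ (not_lt.1 hn))
        dsimp only at h1 hn
        rw [h1] at hn
        exact hn hx
      · intro hy
        obtain ⟨x, rfl⟩ := hbij.2 y
        refine ⟨x, ?_, rfl⟩
        rw [mem_ball_zero_iff]
        by_contra hn
        dsimp only at hy
        rw [hout x (not_lt.1 hn)] at hy
        exact hn hy
    have hderiv : ∀ x ∈ Metric.ball (0 : E) 1, HasFDerivWithinAt (fun x => x + t • g x)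
        (1 + t • fderiv ℝ h x) (Metric.ball 0 1) x := by
      intro x hx
      have h1 : HasFDerivAt (fun x => x + t • h x) (1 + t • fderiv ℝ h x) x :=
        (hasFDerivAt_id x).add ((hdiff x).const_smul t)
      refine h1.hasFDerivWithinAt.congr (fun y hy => ?_) ?_
      · rw [hgball y hy]
      · rw [hgball x hx]
    have h2 := integral_image_eq_integral_abs_det_fderiv_smul μ measurableSet_ball hderiv
      hbij.1.injOn (fun _ => (1 : ℝ))
    rw [himage] at h2
    simp only [smul_eq_mul, mul_one, integral_const, MeasurableSet.univ, measureReal_restrict_apply,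
      Set.univ_inter] at h2
    rw [h2]
    refine setIntegral_congr_fun measurableSet_ball fun x hx => ?_
    have hnorm : ‖fderiv ℝ h x‖ ≤ K := norm_fderiv_le_of_lipschitzOn ℝ
      (Metric.closedBall_mem_nhds_of_mem hx) hK
    exact (abs_of_pos (det_one_add_pos _ ht.le hnorm htK')).symm
  have hone := integral_eq_of_polynomial (μ := μ.restrict (Metric.ball 0 1)) (finrank ℝ E)
    (fun t x => (1 + t • fderiv ℝ h x : E →L[ℝ] E).det)
    (fun x => exists_polynomial_det (fderiv ℝ h x))
    (fun t => ((hcont t).continuousOn.integrableOn_compact (isCompact_closedBall 0 1)).mono_set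
      Metric.ball_subset_closedBall)
    (δ := 1 / (K + 1)) (by positivity) hsmall 1
  have hzero : ∀ x, (1 + (1 : ℝ) • fderiv ℝ h x : E →L[ℝ] E).det = 0 := by
    intro x
    have h1 : fderiv ℝ h x = fderiv ℝ r x - 1 := by
      refine (hdiff x).unique ?_
      exact ((hr.differentiable one_ne_zero x).hasFDerivAt).sub (hasFDerivAt_id x)
    rw [h1, one_smul, add_sub_cancel, hdet]
  simp only [hzero, integral_zero] at hone
  have hpos : 0 < μ.real (Metric.ball (0 : E) 1) := by
    rw [measureReal_def, ENNReal.toReal_pos_iff]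
    exact ⟨Metric.measure_ball_pos μ 0 one_pos, measure_ball_lt_top⟩
  exact hpos.ne hone

/-- Smooth `F` to some `g` with error less than `‖F‖`, so that `g` has no zeros, and without change
where `‖x‖ ≥ 3/4`; this is possible since `F` is already smooth where `‖x‖ > 1/2`. Then `g / ‖g‖` is
the identity on the unit sphere and has norm `1` everywhere, so its derivative takes values
orthogonal to it and is singular. -/
theorem not_exists_nonvanishing {E : Type*} [NormedAddCommGroup E] [InnerProductSpace ℝ E]
    [FiniteDimensional ℝ E] {F : E → E} (hF : Continuous F) (hF0 : ∀ x, F x ≠ 0)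
    (hF1 : ∀ x, 1 / 2 ≤ ‖x‖ → F x = x) : False := by
  let _ : MeasurableSpace E := borel E
  have : BorelSpace E := ⟨rfl⟩
  have hS : IsClosed {x : E | 3 / 4 ≤ ‖x‖} := isClosed_le continuous_const continuous_norm
  have hU : IsOpen {x : E | 1 / 2 < ‖x‖} := isOpen_lt continuous_const continuous_norm
  have hSU : {x : E | 1 / 2 < ‖x‖} ∈ 𝓝ˢ {x : E | 3 / 4 ≤ ‖x‖} := by
    refine hU.mem_nhdsSet.2 fun x hx => ?_
    have : 3 / 4 ≤ ‖x‖ := hx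
    show 1 / 2 < ‖x‖
    linarith
  have hsm : ContDiffOn ℝ (1 : ℕ∞) F {x : E | 1 / 2 < ‖x‖} :=
    contDiffOn_id.congr fun x hx => hF1 x (le_of_lt hx)
  obtain ⟨g, hg, hgF, hgS, -⟩ := hF.exists_contDiff_approx_and_eqOn 1 hF.norm
    (fun x => norm_pos_iff.2 (hF0 x)) hS hSU hsm
  have hg0 : ∀ x, g x ≠ 0 := by
    intro x hx
    have := hgF x
    rw [hx, dist_zero_left] at this
    exact lt_irrefl _ this
  have hr : ContDiff ℝ 1 fun x => ‖g x‖⁻¹ • g x :=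
    (ContDiff.inv (ContDiff.norm ℝ hg hg0) fun x => norm_ne_zero_iff.2 (hg0 x)).smul hg
  set r : E → E := fun x => ‖g x‖⁻¹ • g x with hrdef
  have hrnorm : ∀ x, ‖r x‖ = 1 := fun x => norm_unitVec (hg0 x)
  refine not_exists_contDiff_retraction hr (fun x hx => ?_) fun x => ?_
  · have h1 : 3 / 4 ≤ ‖x‖ := by rw [hx]; norm_num
    have h2 : g x = x := by rw [hgS h1, hF1 x (by linarith)]
    rw [hrdef]
    simp only [h2, hx, inv_one, one_smul]
  · have hd : HasFDerivAt r (fderiv ℝ r x) x := (hr.differentiable one_ne_zero x).hasFDerivAt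
    have h1 : ∀ v, inner ℝ (r x) (fderiv ℝ r x v) = 0 := by
      intro v
      have h2 := hd.inner ℝ hd
      have h3 : (fun y => inner ℝ (r y) (r y)) = fun _ => (1 : ℝ) := by
        funext y
        rw [real_inner_self_eq_norm_sq, hrnorm, one_pow]
      rw [h3] at h2
      have h4 := congrArg (fun L : E →L[ℝ] ℝ => L v) (h2.unique (hasFDerivAt_const 1 x))
      simp only [ContinuousLinearMap.comp_apply, ContinuousLinearMap.prod_apply,
        fderivInnerCLM_apply, zero_apply, real_inner_comm (r x)] at h4
      linarith
    by_contra hdet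
    have hu : IsUnit (LinearMap.det (fderiv ℝ r x : E →ₗ[ℝ] E)) := isUnit_iff_ne_zero.2 hdet
    obtain ⟨v, hv⟩ := (LinearEquiv.ofIsUnitDet (v := Module.finBasis ℝ E)
      (v' := Module.finBasis ℝ E) (f := (fderiv ℝ r x : E →ₗ[ℝ] E))
      (by rwa [LinearMap.det_toMatrix])).surjective (r x)
    have h5 := h1 v
    have hv' : fderiv ℝ r x v = r x := hv
    rw [hv', real_inner_self_eq_norm_sq, hrnorm] at h5
    norm_num at h5

open Classical in
-- The inclusion of the boundary sphere is the map that does not extend: an extension, continued by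
-- the identity outside the ball, would contradict `not_exists_nonvanishing`.
theorem not_nonvanishingExtension_closedBall (n : ℕ) :
    ¬ NonvanishingExtension n (Metric.closedBall (0 : EuclideanSpace ℝ (Fin n)) (1 / 2)) := by
  intro h
  obtain ⟨F, hF, hF0, hFe⟩ := h (Metric.sphere 0 (1 / 2)) Metric.sphere_subset_closedBall
    Metric.isClosed_sphere (fun x => WithLp.ofLp x) (PiLp.continuous_ofLp 2 _).continuousOn (by
      intro a ha h0
      have h1 : a = 0 := by
        ext i
        exact congrFun h0 i
      rw [h1] at ha
      norm_num at ha)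
  let G : EuclideanSpace ℝ (Fin n) → EuclideanSpace ℝ (Fin n) := fun x => WithLp.toLp 2 (F x)
  have hG : ContinuousOn G (Metric.closedBall 0 (1 / 2)) :=
    (PiLp.continuous_toLp 2 _).comp_continuousOn hF
  have hS : IsClosed {x : EuclideanSpace ℝ (Fin n) | 1 / 2 ≤ ‖x‖} :=
    isClosed_le continuous_const continuous_norm
  obtain ⟨hc, he⟩ := Set.piecewise_continuousOn_union Metric.isClosed_closedBall hS hG
    (g := fun x => x) continuousOn_id (by
      rintro x ⟨h1, h2⟩
      have h3 : ‖x‖ ≤ 1 / 2 := mem_closedBall_zero_iff.1 h1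
      have h4 : x ∈ Metric.sphere (0 : EuclideanSpace ℝ (Fin n)) (1 / 2) :=
        mem_sphere_zero_iff_norm.2 (le_antisymm h3 h2)
      show WithLp.toLp 2 (F x) = x
      rw [hFe h4])
  refine not_exists_nonvanishing (F := (Metric.closedBall 0 (1 / 2)).piecewise G fun x => x)
    ?_ (fun x => ?_) fun x hx => he hx
  · rw [← continuousOn_univ]
    refine hc.mono fun x _ => ?_
    rcases le_total ‖x‖ (1 / 2) with h1 | h1
    · exact Or.inl (mem_closedBall_zero_iff.2 h1)
    · exact Or.inr h1
  · by_cases hx : x ∈ Metric.closedBall (0 : EuclideanSpace ℝ (Fin n)) (1 / 2)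
    · rw [Set.piecewise_eq_of_mem _ _ _ hx]
      intro h0
      exact hF0 x hx (congrArg WithLp.ofLp h0)
    · rw [Set.piecewise_eq_of_notMem _ _ _ hx]
      rintro rfl
      exact hx (Metric.mem_closedBall_self (by norm_num))

theorem not_hasSmallInductiveDimensionLT_closedBall (n : ℕ) :
    ¬ HasSmallInductiveDimensionLT
      (Metric.closedBall (0 : EuclideanSpace ℝ (Fin n)) (1 / 2)) n := by
  intro h
  have : CompactSpace (Metric.closedBall (0 : EuclideanSpace ℝ (Fin n)) (1 / 2)) :=
    isCompact_iff_compactSpace.1 (isCompact_closedBall _ _)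
  exact not_nonvanishingExtension_closedBall n (.of_subtype h.nonvanishingExtension)

end NoRetraction

/-! ### Spheres and projective spaces have the expected small inductive dimension -/

section UpperBound

theorem sqrt_one_sub_sq_pos {r : ℝ} (hr0 : 0 < r) (hr1 : r ≤ 1) :
    0 < √(1 - (1 - r ^ 2 / 2) ^ 2) := by
  have : r ^ 2 ≤ 1 := by nlinarith
  have : 0 < r ^ 2 := by positivity
  exact Real.sqrt_pos.2 (by nlinarith)

/-- Distance `r` between unit vectors means inner product `1 - r ^ 2 / 2`; the rest of `w` is
orthogonal to `u` and has a fixed length. So a metric sphere around `u` in the unit sphere is a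
rescaled unit sphere of the orthogonal complement. -/
theorem exists_eq_add_of_norm_sub {E : Type*} [NormedAddCommGroup E] [InnerProductSpace ℝ E]
    {u w : E} (hu : ‖u‖ = 1) (hw : ‖w‖ = 1) {r : ℝ} (hr : ‖u - w‖ = r) (hr0 : 0 < r)
    (hr1 : r ≤ 1) : ∃ v : (ℝ ∙ u)ᗮ, ‖v‖ = 1 ∧
      w = (1 - r ^ 2 / 2) • u + √(1 - (1 - r ^ 2 / 2) ^ 2) • (v : E) := by
  set c := 1 - r ^ 2 / 2 with hc
  have hs : 0 < 1 - c ^ 2 := by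
    have : r ^ 2 ≤ 1 := by nlinarith
    have : 0 < r ^ 2 := by positivity
    nlinarith
  have hin : inner ℝ u w = c := by
    have := norm_sub_sq_real u w
    rw [hu, hw, hr] at this
    linarith
  have horth : w - c • u ∈ (ℝ ∙ u)ᗮ := by
    rw [Submodule.mem_orthogonal_singleton_iff_inner_right, inner_sub_right, inner_smul_right, hin,
      real_inner_self_eq_norm_sq, hu]
    ring
  have hnorm : ‖w - c • u‖ = √(1 - c ^ 2) := by
    rw [eq_comm, Real.sqrt_eq_iff_mul_self_eq hs.le (norm_nonneg _), ← sq, norm_sub_sq_real,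
      norm_smul, hu, hw, inner_smul_right, real_inner_comm, hin, Real.norm_eq_abs, mul_one, sq_abs]
    ring
  have hs' : √(1 - c ^ 2) ≠ 0 := (Real.sqrt_pos.2 hs).ne'
  refine ⟨(√(1 - c ^ 2))⁻¹ • ⟨w - c • u, horth⟩, ?_, ?_⟩
  · rw [norm_smul, Submodule.coe_norm, hnorm, norm_inv, Real.norm_of_nonneg (Real.sqrt_nonneg _),
      inv_mul_cancel₀ hs']
  · rw [Submodule.coe_smul, smul_smul, mul_inv_cancel₀ hs', one_smul, add_sub_cancel]

theorem exists_isOpen_of_metric {n : ℕ} {X : Type*} [MetricSpace X] {x : X} {O : Set X}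
    (hx : x ∈ O) (hO : IsOpen O)
    (h : ∀ r : ℝ, 0 < r → r ≤ 1 → HasSmallInductiveDimensionLT {y | dist y x = r} n) :
    ∃ U : Set X, IsOpen U ∧ x ∈ U ∧ U ⊆ O ∧ HasSmallInductiveDimensionLT (frontier U) n := by
  obtain ⟨ε, hε, hb⟩ := Metric.isOpen_iff.1 hO x hx
  refine ⟨Metric.ball x (min ε 1), Metric.isOpen_ball, Metric.mem_ball_self (by positivity),
    (Metric.ball_subset_ball (min_le_left _ _)).trans hb, ?_⟩
  exact .of_isInducing (IsEmbedding.inclusion Metric.frontier_ball_subset_sphere).isInducing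
    (h (min ε 1) (by positivity) (min_le_right _ _))

universe u

theorem hasSmallInductiveDimensionLT_sphere {n : ℕ} :
    ∀ {E : Type u} [NormedAddCommGroup E] [InnerProductSpace ℝ E] [FiniteDimensional ℝ E],
      finrank ℝ E = n → HasSmallInductiveDimensionLT (Metric.sphere (0 : E) 1) n := by
  induction n with
  | zero =>
    intro E _ _ _ h
    rw [hasSmallInductiveDimensionLT_zero_iff]
    have := finrank_zero_iff.1 h
    refine ⟨fun x => ?_⟩
    have := norm_eq_of_mem_sphere x
    rw [Subsingleton.elim (x : E) 0, norm_zero] at this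
    exact zero_ne_one this
  | succ n ih =>
    intro E _ _ _ h
    refine .succ_of_nhds fun u O hu hO => exists_isOpen_of_metric hu hO fun r hr0 hr1 => ?_
    have hun : ‖(u : E)‖ = 1 := norm_eq_of_mem_sphere u
    have hfin : finrank ℝ (ℝ ∙ (u : E))ᗮ = n := by
      have : Fact (finrank ℝ E = n + 1) := ⟨h⟩
      exact Submodule.finrank_orthogonal_span_singleton (ne_zero_of_mem_unit_sphere u)
    have hs : √(1 - (1 - r ^ 2 / 2) ^ 2) ≠ 0 := (sqrt_one_sub_sq_pos hr0 hr1).ne'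
    refine .of_range_subset (K := Metric.sphere (0 : (ℝ ∙ (u : E))ᗮ) 1) (X := E)
      (g := fun v => (1 - r ^ 2 / 2) • (u : E) + √(1 - (1 - r ^ 2 / 2) ^ 2) • (v : E))
      (by fun_prop) (fun v v' hv => ?_) (ih hfin)
      (IsInducing.subtypeVal.comp IsInducing.subtypeVal) fun y => ?_
    · exact Subtype.ext (Subtype.ext (smul_right_injective E hs (add_left_cancel hv)))
    · have hy : ‖(u : E) - y‖ = r := by
        rw [← dist_eq_norm, dist_comm]
        exact y.2
      obtain ⟨v, hv, hyv⟩ := exists_eq_add_of_norm_sub hun (norm_eq_of_mem_sphere y.1) hy hr0 hr1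
      exact ⟨⟨v, mem_sphere_zero_iff_norm.2 hv⟩, hyv.symm⟩

section

variable {V : Type*} [NormedAddCommGroup V] [NormedSpace ℝ V]

theorem unitVec_ne_zero {v : V} (hv : v ≠ 0) : unitVec v ≠ 0 :=
  norm_ne_zero_iff.1 (by rw [norm_unitVec hv]; exact one_ne_zero)

theorem mk_unitVec {v : V} (hv : v ≠ 0) :
    Projectivization.mk ℝ (unitVec v) (unitVec_ne_zero hv) = Projectivization.mk ℝ v hv := by
  rw [Projectivization.mk_eq_mk_iff']
  exact ⟨‖v‖⁻¹, rfl⟩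

theorem mk_neg {v : V} (hv : v ≠ 0) :
    Projectivization.mk ℝ (-v) (neg_ne_zero.2 hv) = Projectivization.mk ℝ v hv := by
  rw [Projectivization.mk_eq_mk_iff']
  exact ⟨-1, by rw [neg_one_smul]⟩

theorem dist_mk {z w : V} (hz : z ≠ 0) (hw : w ≠ 0) :
    dist (Projectivization.mk ℝ z hz) (Projectivization.mk ℝ w hw) =
      min ‖unitVec z - unitVec w‖ ‖unitVec z + unitVec w‖ :=
  projDist_mk z w hz hw

theorem Continuous.projectivization_mk {X : Type*} [TopologicalSpace X] {f : X → V}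
    (hf : Continuous f) (h0 : ∀ x, f x ≠ 0) :
    Continuous fun x => Projectivization.mk ℝ (f x) (h0 x) :=
  isOpenQuotientMap_mk'.continuous.comp (hf.subtype_mk h0)

instance [FiniteDimensional ℝ V] : CompactSpace (ℙ ℝ V) := by
  have : ProperSpace V := FiniteDimensional.proper ℝ V
  have : CompactSpace (Metric.sphere (0 : V) 1) :=
    isCompact_iff_compactSpace.1 (isCompact_sphere _ _)
  have hc : Continuous fun x : Metric.sphere (0 : V) 1 =>
      Projectivization.mk ℝ (x : V) (ne_zero_of_mem_unit_sphere x) :=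
    continuous_subtype_val.projectivization_mk _
  refine ⟨?_⟩
  convert! isCompact_range hc
  refine (Set.eq_univ_of_forall fun p => ?_).symm
  induction p using Projectivization.ind with | h v hv
  exact ⟨⟨unitVec v, mem_sphere_zero_iff_norm.2 (norm_unitVec hv)⟩, mk_unitVec hv⟩

end

/-- A line at distance `r` from the line of `u` has a unit vector at distance `r` from `u`, after a
change of sign. So metric spheres are covered by the unit sphere of the orthogonal complement, as in
the case of spheres. -/
theorem hasSmallInductiveDimensionLT_projectivization {E : Type u} [NormedAddCommGroup E]
    [InnerProductSpace ℝ E] [FiniteDimensional ℝ E] :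
    HasSmallInductiveDimensionLT (ℙ ℝ E) (finrank ℝ E) := by
  cases h : finrank ℝ E with
  | zero =>
    have := finrank_zero_iff.1 h
    rw [hasSmallInductiveDimensionLT_zero_iff]
    infer_instance
  | succ n =>
    refine .succ_of_nhds fun p O hp hO => exists_isOpen_of_metric hp hO fun r hr0 hr1 => ?_
    induction p using Projectivization.ind with | h v₀ hv₀
    set u := unitVec v₀ with hu
    have hun : ‖u‖ = 1 := norm_unitVec hv₀
    have hu0 : u ≠ 0 := unitVec_ne_zero hv₀
    have hfin : finrank ℝ (ℝ ∙ u)ᗮ = n := by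
      have : Fact (finrank ℝ E = n + 1) := ⟨h⟩
      exact Submodule.finrank_orthogonal_span_singleton hu0
    have hs : √(1 - (1 - r ^ 2 / 2) ^ 2) ≠ 0 := (sqrt_one_sub_sq_pos hr0 hr1).ne'
    -- The bound `r ≤ 1` makes the common `u`-coordinate nonzero; it then fixes the scale of a
    -- representative and gives injectivity.
    have hc : 1 - r ^ 2 / 2 ≠ 0 := by nlinarith
    have hin : ∀ v : (ℝ ∙ u)ᗮ, inner ℝ u ((1 - r ^ 2 / 2) • u +
        √(1 - (1 - r ^ 2 / 2) ^ 2) • (v : E)) = 1 - r ^ 2 / 2 := by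
      intro v
      rw [inner_add_right, inner_smul_right, inner_smul_right, real_inner_self_eq_norm_sq, hun,
        Submodule.mem_orthogonal_singleton_iff_inner_right.1 v.2]
      ring
    have h0 : ∀ v : (ℝ ∙ u)ᗮ, (1 - r ^ 2 / 2) • u + √(1 - (1 - r ^ 2 / 2) ^ 2) • (v : E) ≠ 0 := by
      intro v hv
      have := hin v
      rw [hv, inner_zero_right] at this
      exact hc this.symm
    refine .of_range_subset (K := Metric.sphere (0 : (ℝ ∙ u)ᗮ) 1) (X := ℙ ℝ E)
      (g := fun v => Projectivization.mk ℝ _ (h0 v))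
      (Continuous.projectivization_mk (by fun_prop) _) (fun v v' hv => ?_)
      (hasSmallInductiveDimensionLT_sphere hfin) IsInducing.subtypeVal fun y => ?_
    · obtain ⟨a, ha⟩ := (Projectivization.mk_eq_mk_iff' ℝ _ _ _ _).1 hv
      have h1 := congrArg (inner ℝ u) ha
      rw [inner_smul_right, hin, hin, mul_eq_right₀ hc] at h1
      rw [h1, one_smul] at ha
      exact (Subtype.ext (Subtype.ext (smul_right_injective E hs (add_left_cancel ha)))).symm
    · obtain ⟨q, hq⟩ := y
      induction q using Projectivization.ind with | h w hw
      have key : ∀ w' : E, ‖w'‖ = 1 → ‖u - w'‖ = r → ∀ hw' : w' ≠ 0,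
          Projectivization.mk ℝ w' hw' ∈ Set.range fun v : Metric.sphere (0 : (ℝ ∙ u)ᗮ) 1 =>
            Projectivization.mk ℝ _ (h0 v) := by
        intro w' h1 h2 hw'
        obtain ⟨v, hv, hyv⟩ := exists_eq_add_of_norm_sub hun h1 h2 hr0 hr1
        refine ⟨⟨v, mem_sphere_zero_iff_norm.2 hv⟩, ?_⟩
        simp only [← hyv]
      have hq' : min ‖unitVec w - u‖ ‖unitVec w + u‖ = r := (dist_mk hw hv₀).symm.trans hq
      have hwn := norm_unitVec hw
      have hw0 := unitVec_ne_zero hw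
      change Projectivization.mk ℝ w hw ∈ _
      rw [← mk_unitVec hw]
      rcases min_choice ‖unitVec w - u‖ ‖unitVec w + u‖ with h1 | h1
      · exact key _ hwn (by rw [norm_sub_rev, ← h1, hq']) hw0
      · rw [← mk_neg hw0]
        exact key _ (by rw [norm_neg, hwn]) (by rw [sub_neg_eq_add, add_comm, ← h1, hq']) _

end UpperBound

/-! ### Existence of a real Jordan decomposition -/

section JordanExistence

open Polynomial

/-- If `N ^ s` kills the vectors `g c` and the vectors `N ^ (s - 1) (g c)` are linearly
independent, then so are the vectors of the chains generated by the `g c`. -/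
theorem linearIndependent_chains {W : Type*} [AddCommGroup W] [Module ℝ W] (N : End ℝ W)
    {s m : ℕ} (g : Fin m → W) (h0 : ∀ c, (N ^ s) (g c) = 0)
    (hind : LinearIndependent ℝ fun c => (N ^ (s - 1)) (g c)) :
    LinearIndependent ℝ fun p : Fin m × Fin s => (N ^ (s - (p.2 + 1))) (g p.1) := by
  rw [Fintype.linearIndependent_iff] at hind ⊢
  intro a ha
  have hpow : ∀ k, s ≤ k → ∀ c, (N ^ k) (g c) = 0 := by
    intro k hk c
    rw [← Nat.sub_add_cancel hk, pow_add, Module.End.mul_apply, h0, map_zero]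
  -- Coefficients vanish from position `s - 1` downwards: `N ^ k` kills all positions below `k`, and
  -- those above `k` are covered by the induction.
  have key : ∀ d : ℕ, ∀ k : Fin s, s - 1 - k = d → ∀ c, a (c, k) = 0 := by
    intro d
    induction d using Nat.strong_induction_on with
    | _ d ih =>
      intro k hk
      have h1 := congrArg (N ^ (k : ℕ)) ha
      rw [map_sum, map_zero, Fintype.sum_prod_type] at h1
      refine hind (fun c => a (c, k)) ?_
      rw [← h1]
      refine Finset.sum_congr rfl fun c _ => ?_
      rw [Finset.sum_eq_single k]
      · rw [map_smul, ← Module.End.mul_apply, ← pow_add]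
        have h2 : (k : ℕ) + (s - (k + 1)) = s - 1 := by
          have := k.2
          omega
        simp only [h2]
      · intro j _ hjk
        rcases lt_or_gt_of_ne (fun h => hjk (Fin.ext h) : (j : ℕ) ≠ k) with hj | hj
        · rw [map_smul, ← Module.End.mul_apply, ← pow_add, hpow _ (by dsimp only; omega), smul_zero]
        · rw [ih (s - 1 - j) (by have := j.2; omega) j rfl c, zero_smul, map_zero]
      · exact fun h => (h (Finset.mem_univ _)).elim
  rintro ⟨c, k⟩
  exact key _ k rfl c

theorem span_range_eq_range {ι V W : Type*} [Fintype ι] [AddCommGroup V] [Module ℝ V]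
    [AddCommGroup W] [Module ℝ W] [FiniteDimensional ℝ W] {φ : W →ₗ[ℝ] V} (hφ : Function.Injective φ)
    {e : ι → V} (he : LinearIndependent ℝ e) (hmem : ∀ i, e i ∈ LinearMap.range φ)
    (hcard : Fintype.card ι = finrank ℝ W) :
    Submodule.span ℝ (Set.range e) = LinearMap.range φ := by
  refine Submodule.eq_of_le_of_finrank_eq ?_ ?_
  · rw [Submodule.span_le]
    rintro _ ⟨i, rfl⟩
    exact hmem i
  · rw [finrank_span_eq_card he, LinearMap.finrank_range_of_inj hφ, hcard]

variable {V : Type*} [AddCommGroup V] [Module ℝ V]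

theorem finiteDimensional_quotient {q : ℝ[X]} (hq : q ≠ 0) :
    FiniteDimensional ℝ (ℝ[X] ⧸ Ideal.span {q}) :=
  (AdjoinRoot.powerBasis hq).finite

theorem not_pow_dvd_pow_pred {p : ℝ[X]} (hp : Irreducible p) {s : ℕ} (hs : 1 ≤ s) :
    ¬ p ^ s ∣ p ^ (s - 1) := by
  intro h
  have := (pow_dvd_pow_iff hp.ne_zero hp.not_isUnit).1 h
  omega

theorem isRealJordanSubspace_of_X (A : End ℝ V) {s : ℕ} (hs : 1 ≤ s)
    (φ : (ℝ[X] ⧸ Ideal.span {(X : ℝ[X]) ^ s}) →ₗ[ℝ] V) (hφ : Function.Injective φ)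
    (hA : ∀ q, φ (Ideal.Quotient.mk _ X * q) = A (φ q)) :
    IsRealJordanSubspace A (LinearMap.range φ) s := by
  set x : ℝ[X] ⧸ Ideal.span {(X : ℝ[X]) ^ s} := Ideal.Quotient.mk _ X with hx
  have hxs : x ^ s = 0 := by
    rw [hx, ← map_pow, Ideal.Quotient.eq_zero_iff_mem]
    exact Ideal.mem_span_singleton_self _
  have hxs' : x ^ (s - 1) ≠ 0 := by
    rw [hx, ← map_pow, Ne, Ideal.Quotient.eq_zero_iff_mem, Ideal.mem_span_singleton]
    exact not_pow_dvd_pow_pred irreducible_X hs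
  have := finiteDimensional_quotient (pow_ne_zero s (X_ne_zero (R := ℝ)))
  have hch := linearIndependent_chains (LinearMap.mulLeft ℝ x) (s := s) (m := 1) (fun _ => 1)
    (fun _ => by rw [LinearMap.pow_mulLeft, LinearMap.mulLeft_apply, hxs, zero_mul])
    (by
      rw [linearIndependent_unique_iff, LinearMap.pow_mulLeft, LinearMap.mulLeft_apply, mul_one]
      exact hxs')
  have hli : LinearIndependent ℝ fun k : Fin s => φ (x ^ (s - (k + 1))) := by
    have h1 := (hch.comp (fun k : Fin s => ((0 : Fin 1), k)) fun _ _ h => (Prod.ext_iff.1 h).2).map'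
      φ (LinearMap.ker_eq_bot.2 hφ)
    convert! h1 using 2 with k
    simp only [Function.comp_apply, LinearMap.pow_mulLeft, LinearMap.mulLeft_apply, mul_one]
  -- At `k = 0` the formula would give `x ^ s = 0`, so the case split is consistent with it.
  refine Or.inl ⟨fun k => if k = 0 then 0 else φ (x ^ (s - k)), if_pos rfl, fun k hk => ?_, ?_, ?_⟩
  · simp only [Nat.add_eq_zero_iff, one_ne_zero, and_false, if_false]
    rw [← hA, ← pow_succ', show s - (k + 1) + 1 = s - k by omega]
    split_ifs with h
    · rw [h, Nat.sub_zero, hxs, map_zero]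
    · rfl
  · simpa using hli
  · simp only [Nat.add_eq_zero_iff, one_ne_zero, and_false, if_false]
    refine span_range_eq_range hφ hli (fun i => ⟨_, rfl⟩) ?_
    rw [finrank_quotient_span_eq_natDegree, natDegree_X_pow, Fintype.card_fin]

/-- For `P = X ^ 2 + β ^ 2` the value `P(x)` is nilpotent and `P'(x) = 2x` is a unit, so `x` differs
by a nilpotent `ν` from an exact root `r` of `P`, and `j = r / β` squares to `-1`. Since `P(x) = ν
(2x - ν)` with a unit as second factor, `ν` has the same order of nilpotency as `P(x)`. -/
theorem exists_eq_smul_add_nilpotent {R : Type*} [CommRing R] [Algebra ℝ R] {x : R} {β : ℝ}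
    (hβ : β ≠ 0) {s : ℕ} (h : (x ^ 2 + algebraMap ℝ R (β ^ 2)) ^ s = 0)
    (h' : (x ^ 2 + algebraMap ℝ R (β ^ 2)) ^ (s - 1) ≠ 0) :
    ∃ ν j : R, j * j = -1 ∧ x = β • j + ν ∧ ν ^ s = 0 ∧
      LinearIndependent ℝ ![ν ^ (s - 1), ν ^ (s - 1) * j] := by
  have hP : ∀ y : R, aeval y (X ^ 2 + C (β ^ 2)) = y ^ 2 + algebraMap ℝ R (β ^ 2) := fun y => by
    simp
  have hnil : IsNilpotent (aeval x (X ^ 2 + C (β ^ 2))) := ⟨s, by rw [hP, h]⟩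
  have hβu : IsUnit (algebraMap ℝ R (β ^ 2)) := (isUnit_iff_ne_zero.2 (pow_ne_zero 2 hβ)).map _
  have hxu : IsUnit x := by
    have h1 : IsUnit (x ^ 2) := by
      have : x ^ 2 = aeval x (X ^ 2 + C (β ^ 2)) + -algebraMap ℝ R (β ^ 2) := by rw [hP]; ring
      rw [this]
      exact hnil.isUnit_add_right_of_commute hβu.neg (.all _ _)
    exact (isUnit_pow_iff two_ne_zero).1 h1
  have h2u : IsUnit (2 : R) := by
    have := (isUnit_iff_ne_zero.2 (two_ne_zero (α := ℝ))).map (algebraMap ℝ R)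
    rwa [map_ofNat] at this
  have hder : IsUnit (aeval x (derivative (X ^ 2 + C (β ^ 2)))) := by
    have : aeval x (derivative (X ^ 2 + C (β ^ 2))) = 2 * x := by
      rw [derivative_add, derivative_C, add_zero, derivative_X_pow]
      simp [map_ofNat]
    rw [this]
    exact h2u.mul hxu
  obtain ⟨r, ⟨hν, hr⟩, -⟩ := existsUnique_nilpotent_sub_and_aeval_eq_zero hnil hder
  have hr2 : r ^ 2 = -algebraMap ℝ R (β ^ 2) := by
    rw [hP] at hr
    exact eq_neg_of_add_eq_zero_left hr
  set ν := x - r with hνdef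
  have hfac : x ^ 2 + algebraMap ℝ R (β ^ 2) = ν * (2 * x - ν) := by
    rw [← neg_neg (algebraMap ℝ R (β ^ 2)), ← hr2, hνdef]
    ring
  have hun : IsUnit (2 * x - ν) := by
    rw [sub_eq_neg_add]
    exact hν.neg.isUnit_add_right_of_commute (h2u.mul hxu) (.all _ _)
  have hνs : ν ^ s = 0 := by
    rw [hfac, mul_pow] at h
    exact (hun.pow s).mul_left_eq_zero.1 h
  have hνs' : ν ^ (s - 1) ≠ 0 := by
    intro h0
    rw [hfac, mul_pow, h0, zero_mul] at h'
    exact h' rfl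
  have hj2 : (β⁻¹ • r) * (β⁻¹ • r) = -1 := by
    rw [smul_mul_smul_comm, ← sq r, hr2, smul_neg, Algebra.smul_def, ← map_mul,
      show β⁻¹ * β⁻¹ * β ^ 2 = 1 by field_simp, map_one]
  refine ⟨ν, β⁻¹ • r, hj2, ?_, hνs, ?_⟩
  · rw [smul_smul, mul_inv_cancel₀ hβ, one_smul, hνdef, add_sub_cancel]
  · set j := β⁻¹ • r
    rw [LinearIndependent.pair_iff]
    intro a b hab
    -- Multiply the relation by the conjugate `a - b j`.
    have h2 : (a ^ 2 + b ^ 2) • ν ^ (s - 1) = 0 := by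
      calc (a ^ 2 + b ^ 2) • ν ^ (s - 1)
          = (a ^ 2) • ν ^ (s - 1) - (b ^ 2) • (ν ^ (s - 1) * (j * j)) := by
            rw [hj2, mul_neg_one, smul_neg, sub_neg_eq_add, add_smul]
        _ = (a • ν ^ (s - 1) + b • (ν ^ (s - 1) * j)) * (a • 1 - b • j) := by
            simp only [Algebra.smul_def, map_pow]
            ring
        _ = 0 := by rw [hab, zero_mul]
    rw [smul_eq_zero, or_iff_left hνs'] at h2
    constructor <;> nlinarith [sq_nonneg a, sq_nonneg b]

/-- Writing `x = β j + ν`, the two chains are `ν ^ (s - k)` and `j ν ^ (s - k)`: `ν` moves along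
them and `j` exchanges them up to sign. -/
theorem isRealJordanSubspace_of_quadratic (A : End ℝ V) {s : ℕ} (hs : 1 ≤ s) {β : ℝ} (hβ : β ≠ 0)
    {P : ℝ[X]} (hP : P = X ^ 2 + C (β ^ 2)) (hirr : Irreducible P)
    (φ : (ℝ[X] ⧸ Ideal.span {P ^ s}) →ₗ[ℝ] V)
    (hφ : Function.Injective φ) (hA : ∀ q, φ (Ideal.Quotient.mk _ X * q) = A (φ q)) :
    IsRealJordanSubspace A (LinearMap.range φ) s := by
  set x : ℝ[X] ⧸ Ideal.span {P ^ s} := Ideal.Quotient.mk _ X with hx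
  have hPx : x ^ 2 + algebraMap ℝ _ (β ^ 2) = Ideal.Quotient.mk _ P := by
    conv_rhs => arg 2; rw [hP]
    rw [RingHom.map_add, RingHom.map_pow (Ideal.Quotient.mk _) X]
    rfl
  obtain ⟨ν, j, hj2, hxj, hνs, hνj⟩ := exists_eq_smul_add_nilpotent (x := x) (s := s) hβ (by
      rw [hPx, ← map_pow, Ideal.Quotient.eq_zero_iff_mem]
      exact Ideal.mem_span_singleton_self _) (by
      rw [hPx, ← map_pow, Ne, Ideal.Quotient.eq_zero_iff_mem, Ideal.mem_span_singleton]
      exact not_pow_dvd_pow_pred hirr hs)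
  have hj3 : ∀ y, j * (j * y) = -y := fun y => by
    rw [← mul_assoc, hj2]
    exact neg_one_mul y
  have := finiteDimensional_quotient (pow_ne_zero s hirr.ne_zero)
  have hch := linearIndependent_chains (LinearMap.mulLeft ℝ ν) (s := s) (m := 2) ![1, j]
    (fun _ => by rw [LinearMap.pow_mulLeft, LinearMap.mulLeft_apply, hνs, zero_mul])
    (by
      rw [LinearMap.pow_mulLeft]
      convert! hνj using 1
      funext c
      fin_cases c <;> simp)
  have hli : LinearIndependent ℝ (Sum.elim (fun k : Fin s => φ (ν ^ (s - (k + 1))))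
      fun k : Fin s => φ (j * ν ^ (s - (k + 1)))) := by
    have h1 := (hch.comp (Sum.elim (fun k : Fin s => ((0 : Fin 2), k)) fun k => (1, k)) ?_).map'
      φ (LinearMap.ker_eq_bot.2 hφ)
    · convert! h1 using 1
      funext k
      rcases k with k | k
      · simp [LinearMap.pow_mulLeft]
      · simp [LinearMap.pow_mulLeft, mul_comm j]
    · rintro (k | k) (l | l) h
      · simpa using h
      · simp at h
      · simp at h
      · simpa using h
  refine Or.inr ⟨β, hβ, fun k => if k = 0 then 0 else φ (ν ^ (s - k)),
    fun k => if k = 0 then 0 else φ (j * ν ^ (s - k)), if_pos rfl, if_pos rfl,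
    fun k hk => ⟨?_, ?_⟩, ?_, ?_⟩
  · simp only [Nat.add_eq_zero_iff, one_ne_zero, and_false, if_false]
    rw [← hA, hxj, add_mul, ← pow_succ', show s - (k + 1) + 1 = s - k by omega, map_add,
      smul_mul_assoc, map_smul]
    split_ifs with h
    · rw [h, Nat.sub_zero, hνs, map_zero]
    · rfl
  · simp only [Nat.add_eq_zero_iff, one_ne_zero, and_false, if_false]
    rw [← hA, hxj, add_mul, mul_left_comm ν, ← pow_succ', show s - (k + 1) + 1 = s - k by omega,
      map_add, smul_mul_assoc, map_smul, hj3, map_neg, smul_neg]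
    split_ifs with h
    · rw [h, Nat.sub_zero, hνs, mul_zero, map_zero]
    · rfl
  · simpa using hli
  · simp only [Nat.add_eq_zero_iff, one_ne_zero, and_false, if_false]
    refine span_range_eq_range hφ hli (fun i => ?_) ?_
    · rcases i with i | i
      · exact ⟨_, rfl⟩
      · exact ⟨_, rfl⟩
    · rw [finrank_quotient_span_eq_natDegree, natDegree_pow, hP, natDegree_X_pow_add_C,
        Fintype.card_sum, Fintype.card_fin]
      ring

/-- After complexification `p` splits into linear factors. If no root were an eigenvalue, `p(A)`
would be invertible and could not kill `w`. -/
theorem exists_isRoot_of_aeval_apply_eq_zero [FiniteDimensional ℝ V] {A : End ℝ V}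
    (hA : HasImaginarySpectrum A) {p : ℝ[X]} {w : V} (hw : w ≠ 0) (hp : aeval A p w = 0) :
    ∃ z : ℂ, aeval z p = 0 ∧ z.re = 0 := by
  have hpc : aeval (LinearMap.baseChange ℂ A) (p.map (algebraMap ℝ ℂ)) (1 ⊗ₜ[ℝ] w) = 0 := by
    rw [aeval_map_algebraMap]
    have h1 : aeval (LinearMap.baseChange ℂ A) p = LinearMap.baseChange ℂ (aeval A p) :=
      aeval_algHom_apply (End.baseChangeHom ℝ ℂ V) A p
    rw [h1, LinearMap.baseChange_tmul, hp, TensorProduct.tmul_zero]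
  have hw' : (1 : ℂ) ⊗ₜ[ℝ] w ≠ 0 := by
    intro h
    refine hw (Module.FaithfullyFlat.tensorProduct_mk_injective (A := ℝ) (B := ℂ) V ?_)
    rw [TensorProduct.mk_apply, h, map_zero]
  have hsplit := (IsAlgClosed.splits (p.map (algebraMap ℝ ℂ)))
  by_cases hp0 : p = 0
  · exact ⟨0, by rw [hp0, map_zero], rfl⟩
  have hnu : ¬ IsUnit (aeval (LinearMap.baseChange ℂ A)
      (Multiset.map (fun x : ℂ => X - C x) (p.map (algebraMap ℝ ℂ)).roots).prod) := by
    intro hu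
    have h2 := hsplit.eq_prod_roots
    rw [h2, map_mul, aeval_C, Module.End.mul_apply, Module.algebraMap_end_apply, smul_eq_zero] at hpc
    rcases hpc with h3 | h3
    · rw [leadingCoeff_eq_zero, Polynomial.map_eq_zero] at h3
      exact hp0 h3
    · exact hw' (((Module.End.isUnit_iff _).1 hu).1 (h3.trans (map_zero _).symm))
  obtain ⟨z, hz, hz0⟩ := spectrum.exists_mem_of_not_isUnit_aeval_prod hnu
  refine ⟨z, ?_, hA z (End.hasEigenvalue_iff_mem_spectrum.2 hz)⟩
  rwa [eval_map_algebraMap] at hz0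

theorem associated_of_imaginary_root {p : ℝ[X]} (hp : Irreducible p) {z : ℂ} (hz : aeval z p = 0)
    (hre : z.re = 0) :
    Associated p X ∨ ∃ β : ℝ, β ≠ 0 ∧ Associated p (X ^ 2 + C (β ^ 2)) := by
  by_cases him : z.im = 0
  · left
    have hz0 : z = 0 := Complex.ext hre him
    have hX : X ∣ p := by
      rw [X_dvd_iff, coeff_zero_eq_aeval_zero]
      rw [hz0, ← map_zero (algebraMap ℝ ℂ), aeval_algebraMap_apply] at hz
      exact (map_eq_zero _).1 hz
    exact (irreducible_X.associated_of_dvd hp hX).symm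
  · right
    have h1 := quadratic_dvd_of_aeval_eq_zero_im_ne_zero p hz him
    refine ⟨z.im, him, ?_⟩
    have h2 : (X ^ 2 - C (2 * z.re) * X + C (‖z‖ ^ 2) : ℝ[X]) = X ^ 2 + C (z.im ^ 2) := by
      rw [hre, mul_zero, C_0, zero_mul, sub_zero, ← Complex.normSq_eq_norm_sq, Complex.normSq_apply,
        hre]
      ring_nf
    rw [h2] at h1
    obtain ⟨q, hq⟩ := h1
    rcases hp.isUnit_or_isUnit hq with h3 | h3
    · have h4 := natDegree_eq_zero_of_isUnit h3
      rw [natDegree_X_pow_add_C] at h4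
      exact absurd h4 two_ne_zero
    · exact ((associated_mul_unit_right (X ^ 2 + C (z.im ^ 2) : ℝ[X]) q h3).trans (.of_eq hq.symm)).symm

/-- The class of `p ^ (s - 1)` is nonzero and killed by `p(A)`, so `p` has an imaginary root and is,
up to a unit, `X` or `X ^ 2 + β ^ 2`. The ideal is a variable so that its generator can be exchanged
for an associated one. -/
theorem isRealJordanSubspace_of_cyclic [FiniteDimensional ℝ V] {A : End ℝ V}
    (hA : HasImaginarySpectrum A) {p : ℝ[X]} (hp : Irreducible p) {s : ℕ} (hs : 1 ≤ s)
    {I : Ideal ℝ[X]} (hI : I = Ideal.span {p ^ s}) (φ : (ℝ[X] ⧸ I) →ₗ[ℝ] V)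
    (hφ : Function.Injective φ) (hX : ∀ q, φ (Ideal.Quotient.mk _ X * q) = A (φ q)) :
    IsRealJordanSubspace A (LinearMap.range φ) s := by
  have haeval : ∀ f q : ℝ[X], φ (Ideal.Quotient.mk _ (f * q)) =
      aeval A f (φ (Ideal.Quotient.mk _ q)) := by
    intro f
    induction f using Polynomial.induction_on with
    | C a =>
      intro q
      rw [← smul_eq_C_mul, aeval_C, Module.algebraMap_end_apply, ← map_smul]
      rfl
    | add f g hf hg => intro q; rw [add_mul, RingHom.map_add, map_add, hf, hg, map_add,
        LinearMap.add_apply]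
    | monomial n a h =>
      intro q
      rw [pow_succ, ← mul_assoc, mul_assoc, h, RingHom.map_mul, hX, map_mul (aeval A) (C a * X ^ n), aeval_X,
        Module.End.mul_apply]
  obtain ⟨z, hz, hre⟩ := exists_isRoot_of_aeval_apply_eq_zero hA (p := p)
    (w := φ (Ideal.Quotient.mk _ (p ^ (s - 1)))) (by
      rw [Ne, map_eq_zero_iff φ hφ, Ideal.Quotient.eq_zero_iff_mem, hI, Ideal.mem_span_singleton]
      exact not_pow_dvd_pow_pred hp hs) (by
      rw [← haeval, ← pow_succ', Nat.sub_add_cancel hs, map_eq_zero_iff φ hφ,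
        Ideal.Quotient.eq_zero_iff_mem, hI]
      exact Ideal.mem_span_singleton_self _)
  rcases associated_of_imaginary_root hp hz hre with h | ⟨β, hβ, h⟩
  · have hI' : I = Ideal.span {X ^ s} := by
      rw [hI, Ideal.span_singleton_eq_span_singleton]
      exact h.pow_pow
    subst hI'
    exact isRealJordanSubspace_of_X A hs φ hφ hX
  · have hI' : I = Ideal.span {(X ^ 2 + C (β ^ 2)) ^ s} := by
      rw [hI, Ideal.span_singleton_eq_span_singleton]
      exact h.pow_pow
    subst hI'
    exact isRealJordanSubspace_of_quadratic A hs hβ rfl (h.irreducible hp) φ hφ hX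

theorem nonempty_realJordanDecomposition_of_finite {A : End ℝ V} {κ : Type*} [Fintype κ]
    [DecidableEq κ] (W : κ → Submodule ℝ V) (sz : κ → ℕ) (hpos : ∀ i, 1 ≤ sz i)
    (hW : ∀ i, IsRealJordanSubspace A (W i) (sz i)) (hint : DirectSum.IsInternal W) :
    Nonempty (RealJordanDecomposition A) := by
  let σ := Fintype.equivFin κ
  refine ⟨⟨_, fun k => W (σ.symm k), fun k => sz (σ.symm k), fun k => hpos _, fun k => hW _, ?_⟩⟩
  refine DirectSum.isInternal_submodule_of_iSupIndep_of_iSup_eq_top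
    (hint.submodule_iSupIndep.comp σ.symm.injective) ?_
  rw [← hint.submodule_iSup_eq_top]
  exact σ.symm.iSup_comp (g := W)

/-- This is the structure theorem for the torsion `ℝ[X]`-module that `A` defines on `V`; each
primary cyclic summand is a Jordan subspace. -/
theorem nonempty_realJordanDecomposition [FiniteDimensional ℝ V] {A : End ℝ V}
    (hA : HasImaginarySpectrum A) : Nonempty (RealJordanDecomposition A) := by
  classical
  obtain ⟨ι, _, p, hp, e, ⟨Φ⟩⟩ := Module.equiv_directSum_of_isTorsion (R := ℝ[X])
    (M := Module.AEval' A) (Module.AEval.isTorsion_of_finiteDimensional ℝ V A)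
  let φ : ∀ i, (ℝ[X] ⧸ (ℝ[X] ∙ p i ^ e i)) →ₗ[ℝ] V := fun i =>
    (Module.AEval'.of A).symm.toLinearMap ∘ₗ
      ((Φ.symm.toLinearMap ∘ₗ DirectSum.lof ℝ[X] ι (fun i => ℝ[X] ⧸ (ℝ[X] ∙ p i ^ e i)) i).restrictScalars ℝ)
  let π : ∀ i, V →ₗ[ℝ] (ℝ[X] ⧸ (ℝ[X] ∙ p i ^ e i)) := fun i =>
    ((DirectSum.component ℝ[X] ι (fun i => ℝ[X] ⧸ (ℝ[X] ∙ p i ^ e i)) i ∘ₗ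
      Φ.toLinearMap).restrictScalars ℝ) ∘ₗ (Module.AEval'.of A).toLinearMap
  have hπφ : ∀ i q, π i (φ i q) = q := by
    intro i q
    simp [φ, π, DirectSum.component.lof_self]
  have hπφ' : ∀ i j q, i ≠ j → π i (φ j q) = 0 := by
    intro i j q hij
    simp [φ, π, DirectSum.component.of, hij.symm]
  have hinj : ∀ i, Function.Injective (φ i) := fun i => Function.LeftInverse.injective (hπφ i)
  have hX : ∀ i q, φ i (Ideal.Quotient.mk _ X * q) = A (φ i q) := by
    intro i q
    have h1 : Ideal.Quotient.mk (ℝ[X] ∙ p i ^ e i) X * q = (X : ℝ[X]) • q := by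
      obtain ⟨q, rfl⟩ := Ideal.Quotient.mk_surjective q
      rfl
    rw [h1]
    simp only [φ, LinearMap.comp_apply, LinearMap.restrictScalars_apply, map_smul]
    exact Module.AEval'.of_symm_X_smul _ _
  have hint : DirectSum.IsInternal fun i => LinearMap.range (φ i) := by
    refine DirectSum.isInternal_submodule_of_iSupIndep_of_iSup_eq_top (fun i => ?_) ?_
    · rw [Submodule.disjoint_def]
      rintro _ ⟨q, rfl⟩ hq
      have hle : ⨆ j, ⨆ (_ : j ≠ i), LinearMap.range (φ j) ≤ LinearMap.ker (π i) := by
        refine iSup₂_le fun j hj => ?_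
        rintro _ ⟨r, rfl⟩
        exact hπφ' i j r hj.symm
      have := hle hq
      rw [LinearMap.mem_ker, hπφ] at this
      rw [this, map_zero]
    · rw [eq_top_iff]
      intro v _
      have key : ∀ x, (Module.AEval'.of A).symm (Φ.symm x) ∈ ⨆ i, LinearMap.range (φ i) := by
        intro x
        induction x using DirectSum.induction_on with
        | zero => simp
        | of i q => exact Submodule.mem_iSup_of_mem i ⟨q, rfl⟩
        | add x y hx hy => rw [map_add, map_add]; exact add_mem hx hy
      simpa using key (Φ (Module.AEval'.of A v))
  -- The structure theorem permits exponent `0`, that is, zero summands; these are discarded because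
  -- block sizes must be positive.
  have hpos : ∀ i : {i // LinearMap.range (φ i) ≠ ⊥}, 1 ≤ e i := by
    rintro ⟨i, hi⟩
    by_contra h0
    have h0' : e i = 0 := Nat.lt_one_iff.1 (not_le.1 h0)
    refine hi (LinearMap.range_eq_bot.2 (LinearMap.ext fun q => ?_))
    obtain ⟨q, rfl⟩ := Ideal.Quotient.mk_surjective q
    have : Ideal.Quotient.mk (ℝ[X] ∙ p i ^ e i) q = 0 := by
      rw [Ideal.Quotient.eq_zero_iff_mem, h0', pow_zero]
      exact Ideal.mem_span_singleton.2 (one_dvd _)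
    exact (congrArg (φ i) this).trans (map_zero _)
  refine nonempty_realJordanDecomposition_of_finite
    (fun i : {i // LinearMap.range (φ i) ≠ ⊥} => LinearMap.range (φ i)) (fun i => e i) hpos
    (fun i => ?_) (DirectSum.isInternal_ne_bot_iff.2 hint)
  exact isRealJordanSubspace_of_cyclic hA (hp _) (hpos i) rfl _ (hinj _) (hX _)

end JordanExistence

/-! ### Real eigenspaces -/

section RealEigenspace

variable {V : Type*} [AddCommGroup V] [Module ℝ V] {A : End ℝ V}

theorem one_tmul_injective : Function.Injective fun v : V => (1 : ℂ) ⊗ₜ[ℝ] v :=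
  Module.FaithfullyFlat.tensorProduct_mk_injective (A := ℝ) (B := ℂ) V

theorem apply_eq_zero_of_mem_realEigenspace_zero {v : V} (hv : v ∈ realEigenspace A 0) :
    A v = 0 := by
  rw [realEigenspace, Submodule.mem_comap, Submodule.restrictScalars_mem] at hv
  simp only [Complex.ofReal_zero, mul_zero, neg_zero, sup_idem, End.mem_eigenspace_iff, zero_smul,
    TensorProduct.mk_apply, LinearMap.baseChange_tmul] at hv
  exact one_tmul_injective (hv.trans (TensorProduct.tmul_zero _ _).symm)

theorem apply_apply_of_mem_realEigenspace {α : ℝ} {v : V} (hv : v ∈ realEigenspace A α) :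
    A (A v) = -(α ^ 2) • v := by
  rw [realEigenspace, Submodule.mem_comap, Submodule.restrictScalars_mem, Submodule.mem_sup] at hv
  obtain ⟨a, ha, b, hb, hab⟩ := hv
  rw [End.mem_eigenspace_iff] at ha hb
  have hsq : (Complex.I * α) * (Complex.I * α) = ((-(α ^ 2) : ℝ) : ℂ) := by
    push_cast
    linear_combination (α : ℂ) ^ 2 * Complex.I_sq
  have h1 : LinearMap.baseChange ℂ A (LinearMap.baseChange ℂ A (a + b)) =
      ((-(α ^ 2) : ℝ) : ℂ) • (a + b) := by
    rw [map_add, ha, hb, map_add, map_smul, map_smul, ha, hb, smul_smul, smul_smul, neg_mul_neg,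
      hsq, smul_add]
  rw [hab, TensorProduct.mk_apply, LinearMap.baseChange_tmul, LinearMap.baseChange_tmul,
    TensorProduct.smul_tmul', smul_eq_mul, mul_one] at h1
  refine one_tmul_injective (h1.trans ?_)
  dsimp only
  rw [← TensorProduct.smul_tmul, Complex.real_smul, mul_one]

theorem mem_realEigenspace_zero {v : V} (hv : A v = 0) : v ∈ realEigenspace A 0 := by
  rw [realEigenspace, Submodule.mem_comap, Submodule.restrictScalars_mem]
  refine Submodule.mem_sup_left ?_
  rw [End.mem_eigenspace_iff, TensorProduct.mk_apply, LinearMap.baseChange_tmul, hv,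
    Complex.ofReal_zero, mul_zero, zero_smul, TensorProduct.tmul_zero]

theorem mem_realEigenspace {α : ℝ} {v w : V} (hv : A v = α • w) (hw : A w = -(α • v)) :
    v ∈ realEigenspace A α := by
  rw [realEigenspace, Submodule.mem_comap, Submodule.restrictScalars_mem]
  have h1 : ∀ c : ℂ, LinearMap.baseChange ℂ A (c ⊗ₜ v) = ((α : ℂ) * c) ⊗ₜ w := fun c => by
    rw [LinearMap.baseChange_tmul, hv, ← TensorProduct.smul_tmul, Complex.real_smul]
  have h2 : ∀ c : ℂ, LinearMap.baseChange ℂ A (c ⊗ₜ w) = -(((α : ℂ) * c) ⊗ₜ v) := fun c => by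
    rw [LinearMap.baseChange_tmul, hw, TensorProduct.tmul_neg, ← TensorProduct.smul_tmul,
      Complex.real_smul]
  -- The splitting `v = (v - i w) / 2 + (v + i w) / 2` into eigenvectors for `iα` and `-iα`.
  refine Submodule.mem_sup.2 ⟨(1 / 2 : ℂ) ⊗ₜ v - (Complex.I / 2) ⊗ₜ w, ?_,
    (1 / 2 : ℂ) ⊗ₜ v + (Complex.I / 2) ⊗ₜ w, ?_, ?_⟩
  · rw [End.mem_eigenspace_iff, map_sub, h1, h2, smul_sub, TensorProduct.smul_tmul',
      TensorProduct.smul_tmul', sub_neg_eq_add, add_comm, sub_eq_add_neg, ← TensorProduct.neg_tmul]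
    congr 2
    · simp only [smul_eq_mul]; ring
    · simp only [smul_eq_mul]
      linear_combination ((α : ℂ) / 2) * Complex.I_sq
  · rw [End.mem_eigenspace_iff, map_add, h1, h2, smul_add, TensorProduct.smul_tmul',
      TensorProduct.smul_tmul', add_comm, ← TensorProduct.neg_tmul]
    congr 2
    · simp only [smul_eq_mul]; ring
    · simp only [smul_eq_mul]
      linear_combination ((α : ℂ) / 2) * Complex.I_sq
  · rw [TensorProduct.mk_apply, sub_add_add_cancel, ← TensorProduct.add_tmul]
    norm_num

theorem realEigenspace_le_eigenSum (α : ℝ) : realEigenspace A α ≤ eigenSum A :=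
  le_iSup (realEigenspace A) α

end RealEigenspace

/-! ### Skew-adjoint plus nilpotent endomorphisms -/

section SkewNilpotent

variable {V E : Type*} [AddCommGroup V] [Module ℝ V] [NormedAddCommGroup E]
  [InnerProductSpace ℝ E] {S N : End ℝ V} {T : V →ₗ[ℝ] E}

/-- If `S + N` is semisimple on the cyclic subspace of `v` with eigenvalues `± i α`, then the
nilpotent part `N` kills `v`. -/
theorem nilpotent_apply_eq_zero (hT : Function.Injective T)
    (hskew : ∀ x y, inner ℝ (T (S x)) (T y) = -inner ℝ (T x) (T (S y)))
    (hc : ∀ x, S (N x) = N (S x)) (hN : IsNilpotent N) {α : ℝ} {v : V}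
    (hv : (α = 0 ∧ (S + N) v = 0) ∨ (α ≠ 0 ∧ (S + N) ((S + N) v) = -(α ^ 2) • v)) : N v = 0 := by
  classical
  by_contra hNv
  have hex : ∃ k, (N ^ k) v = 0 := hN.imp fun k hk => by rw [hk, LinearMap.zero_apply]
  obtain ⟨k, hk, hmin⟩ : ∃ k, (N ^ k) v = 0 ∧ ∀ l < k, (N ^ l) v ≠ 0 :=
    ⟨Nat.find hex, Nat.find_spec hex, fun l hl => Nat.find_min hex hl⟩
  have hk2 : 2 ≤ k := by
    by_contra h
    have : k = 0 ∨ k = 1 := by omega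
    rcases this with rfl | rfl
    · exact hNv (by rw [show v = 0 from hk, map_zero])
    · exact hNv (by simpa using hk)
  have hcp : ∀ l x, (N ^ l) ((S + N) x) = (S + N) ((N ^ l) x) := by
    intro l x
    have h1 : Commute N (S + N) := by
      refine LinearMap.ext fun y => ?_
      simp [hc]
    exact LinearMap.congr_fun (h1.pow_left l) x
  obtain ⟨l, rfl⟩ : ∃ l, k = l + 2 := ⟨k - 2, by omega⟩
  -- Replacing `v` by this iterate reduces to `N w ≠ 0` and `N (N w) = 0`.
  set w := (N ^ l) v with hw
  have hu0 : N w ≠ 0 := by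
    have := hmin (l + 1) (by omega)
    rwa [pow_succ', Module.End.mul_apply] at this
  have hNu : N (N w) = 0 := by
    rwa [pow_succ', pow_succ', Module.End.mul_apply, Module.End.mul_apply] at hk
  have hself : ∀ x, inner ℝ (T x) (T x) = 0 → x = 0 := fun x hx =>
    hT ((inner_self_eq_zero.1 hx).trans (map_zero T).symm)
  rcases hv with ⟨rfl, hv⟩ | ⟨hα, hv⟩
  · have hv' : S w + N w = 0 := by
      have := congrArg (N ^ l) hv
      rwa [hcp, map_zero] at this
    have hSw : S w = -N w := eq_neg_of_add_eq_zero_left hv'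
    have hSS : S (S w) = 0 := by rw [hSw, map_neg, hc, hSw, map_neg, hNu, neg_zero, neg_zero]
    have : S w = 0 := hself _ (by rw [hskew, hSS, map_zero, inner_zero_right, neg_zero])
    exact hu0 (by rw [← neg_eq_zero, ← hSw, this])
  · have hv' : S (S w) + (2 : ℝ) • S (N w) = -(α ^ 2) • w := by
      have := congrArg (N ^ l) hv
      rw [hcp, hcp, map_smul] at this
      rw [← this]
      simp only [LinearMap.add_apply, map_add, hNu, hc, ← hw, two_smul]
      abel
    have hNS : S (S (N w)) = -(α ^ 2) • N w := by
      have := congrArg N hv'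
      simpa only [map_add, map_smul, ← hc, hNu, map_zero, smul_zero, add_zero] using this
    -- `Q = S ^ 2 + α ^ 2` is self-adjoint and `Q (Q w) = 0`, so `Q w = 0`. Then `S (N w) = 0`,
    -- which is incompatible with `S (S (N w)) = -α ^ 2 N w ≠ 0`.
    have hQ : S (S w) + (α ^ 2) • w = -((2 : ℝ) • S (N w)) := by
      rw [eq_neg_iff_add_eq_zero, add_right_comm, hv', neg_smul, neg_add_cancel]
    have hQQ : S (S (S (S w) + (α ^ 2) • w)) + (α ^ 2) • (S (S w) + (α ^ 2) • w) = 0 := by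
      rw [hQ]
      simp only [map_neg, map_smul, hNS, smul_neg, neg_smul, neg_neg]
      rw [smul_comm (α ^ 2), add_neg_cancel]
    have hsym : ∀ x y, inner ℝ (T (S (S x) + (α ^ 2) • x)) (T y) =
        inner ℝ (T x) (T (S (S y) + (α ^ 2) • y)) := by
      intro x y
      rw [map_add, map_add, inner_add_left, inner_add_right, hskew, hskew, neg_neg, map_smul,
        map_smul, inner_smul_left, inner_smul_right]
      rfl
    have hQ0 : S (S w) + (α ^ 2) • w = 0 :=
      hself _ (by rw [hsym, hQQ, map_zero, inner_zero_right])
    rw [hQ0, eq_comm, neg_eq_zero, smul_eq_zero, or_iff_right (two_ne_zero' ℝ)] at hQ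
    rw [hQ, map_zero, eq_comm, smul_eq_zero] at hNS
    rcases hNS with h | h
    · exact hα (by simpa using h)
    · exact hu0 h

end SkewNilpotent

/-! ### Jordan bases -/

section JordanBasis

variable {V : Type*} [AddCommGroup V] [Module ℝ V] {A : End ℝ V}

/-- The matrix of `A` on the graded pieces of a real Jordan subspace is skew-symmetric. -/
theorem IsRealJordanSubspace.exists_chains {W : Submodule ℝ V} {s : ℕ} (hs : 1 ≤ s)
    (h : IsRealJordanSubspace A W s) :
    ∃ (m : ℕ) (M : Matrix (Fin m) (Fin m) ℝ) (e : Fin m → ℕ → V), (∀ c, e c 0 = 0) ∧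
      (∀ c, ∀ k < s, A (e c (k + 1)) = (∑ c', M c' c • e c' (k + 1)) + e c k) ∧
      (∀ c c', M c c' = -M c' c) ∧ (∀ c, e c 1 ∈ eigenSum A) ∧
      LinearIndependent ℝ (fun p : Fin m × Fin s => e p.1 (p.2 + 1)) ∧
      Submodule.span ℝ (Set.range fun p : Fin m × Fin s => e p.1 (p.2 + 1)) = W := by
  rcases h with ⟨e, he0, he, hli, hspan⟩ | ⟨α, hα, e, f, he0, hf0, hef, hli, hspan⟩
  · refine ⟨1, 0, fun _ => e, fun _ => he0, fun _ k hk => ?_, fun _ _ => by simp, fun _ => ?_, ?_, ?_⟩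
    · simpa using he k hk
    · exact realEigenspace_le_eigenSum 0 (mem_realEigenspace_zero ((he 0 hs).trans he0))
    · exact hli.comp (fun p : Fin 1 × Fin s => p.2) fun p q h =>
        Prod.ext (Subsingleton.elim _ _) h
    · rw [← hspan]
      congr 1
      ext v
      simp
  · have h1 := hef 0 hs
    rw [he0, hf0, add_zero, add_zero] at h1
    refine ⟨2, !![0, -α; α, 0], ![e, f], ?_, ?_, ?_, ?_, ?_, ?_⟩
    · simpa [Fin.forall_fin_two] using ⟨he0, hf0⟩
    · simp only [Fin.forall_fin_two, Fin.sum_univ_two]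
      exact ⟨fun k hk => by simpa using (hef k hk).1, fun k hk => by simpa using (hef k hk).2⟩
    · simp [Fin.forall_fin_two]
    · simp only [Fin.forall_fin_two]
      refine ⟨realEigenspace_le_eigenSum α (mem_realEigenspace h1.1 h1.2),
        realEigenspace_le_eigenSum α (mem_realEigenspace (w := -e 1) ?_ ?_)⟩
      · simpa using h1.2
      · simpa using h1.1
    · let g : Fin 2 × Fin s → Fin s ⊕ Fin s := fun p => if p.1 = 0 then .inl p.2 else .inr p.2
      have hg : Function.Injective g := by
        rintro ⟨c, k⟩ ⟨c', k'⟩ h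
        fin_cases c <;> fin_cases c' <;> simp_all [g]
      convert! hli.comp g hg using 1
      funext ⟨c, k⟩
      fin_cases c <;> simp [g]
    · rw [← hspan]
      congr 1
      ext v
      simp [Prod.exists, Fin.exists_fin_two]

/-- A basis of `V` that consists of the chains of the Jordan subspaces. The vectors of the `i`-th
subspace are indexed by `(c, k)`, where `c` numbers the chains and `k` is the position in the
chain. -/
structure JordanBasis (J : RealJordanDecomposition A) where
  /-- the number of chains in a Jordan subspace -/
  mult : Fin J.num → ℕ
  /-- the matrix by which `A` acts on the graded pieces of a Jordan subspace -/
  mat : ∀ i, Matrix (Fin (mult i)) (Fin (mult i)) ℝ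
  /-- the basis -/
  toBasis : Basis (Σ i, Fin (mult i) × Fin (J.size i)) ℝ V
  mat_skew : ∀ i c c', mat i c c' = -mat i c' c
  apply_zero : ∀ i c (h : 0 < J.size i), A (toBasis ⟨i, c, ⟨0, h⟩⟩) =
    ∑ c', mat i c' c • toBasis ⟨i, c', ⟨0, h⟩⟩
  apply_succ : ∀ i c k (h : k + 1 < J.size i), A (toBasis ⟨i, c, ⟨k + 1, h⟩⟩) =
    (∑ c', mat i c' c • toBasis ⟨i, c', ⟨k + 1, h⟩⟩) +
      toBasis ⟨i, c, ⟨k, (Nat.lt_succ_self k).trans h⟩⟩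
  mem_eigenSum : ∀ i c (h : 0 < J.size i), toBasis ⟨i, c, ⟨0, h⟩⟩ ∈ eigenSum A
  span_block : ∀ i, Submodule.span ℝ (Set.range fun a => toBasis ⟨i, a⟩) = J.block i

theorem nonempty_jordanBasis (J : RealJordanDecomposition A) : Nonempty (JordanBasis J) := by
  choose m M e he0 he hM heig hli hspan using
    fun i => (J.isJordan i).exists_chains (J.size_pos i)
  let v : ∀ i, Basis (Fin (m i) × Fin (J.size i)) ℝ (J.block i) := fun i =>
    (Basis.span (hli i)).map (LinearEquiv.ofEq _ _ (hspan i))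
  have hv : ∀ i a, ((v i a : J.block i) : V) = e i a.1 (a.2 + 1) := by
    intro i a
    simp [v, Basis.span_apply]
  let b := J.internal.collectedBasis v
  have hb : ∀ i a, b ⟨i, a⟩ = e i a.1 (a.2 + 1) := fun i a => by
    rw [DirectSum.IsInternal.collectedBasis_coe]
    exact hv i a
  refine ⟨⟨m, M, b, hM, ?_, ?_, ?_, ?_⟩⟩
  · intro i c h
    simp only [hb]
    rw [he i c 0 h, he0, add_zero]
  · intro i c k h
    simp only [hb]
    rw [he i c _ h]
  · intro i c h
    rw [hb]
    exact heig i c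
  · intro i
    simp only [hb]
    exact hspan i

end JordanBasis

/-! ### The splitting of an endomorphism given by a Jordan basis -/

namespace JordanBasis

variable {V : Type*} [AddCommGroup V] [Module ℝ V] {A : End ℝ V}
  {J : RealJordanDecomposition A} (B : JordanBasis J)

/-- The nilpotent part of `A`: the shift along the chains of a Jordan basis. -/
def nilpotentPart : End ℝ V :=
  B.toBasis.constr ℝ fun x =>
    if 0 < x.2.2.1 then B.toBasis ⟨x.1, x.2.1, ⟨x.2.2.1 - 1, (Nat.sub_le _ _).trans_lt x.2.2.2⟩⟩
    else 0

/-- The semisimple part of `A`. -/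
def semisimplePart : End ℝ V := A - B.nilpotentPart

theorem nilpotentPart_zero (i c) (h : 0 < J.size i) :
    B.nilpotentPart (B.toBasis ⟨i, c, ⟨0, h⟩⟩) = 0 := by
  rw [nilpotentPart, Basis.constr_basis]
  exact if_neg (lt_irrefl 0)

theorem nilpotentPart_succ (i c k) (h : k + 1 < J.size i) :
    B.nilpotentPart (B.toBasis ⟨i, c, ⟨k + 1, h⟩⟩) =
      B.toBasis ⟨i, c, ⟨k, (Nat.lt_succ_self k).trans h⟩⟩ := by
  rw [nilpotentPart, Basis.constr_basis]
  exact if_pos (Nat.succ_pos k)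

theorem semisimplePart_apply (i c k) : B.semisimplePart (B.toBasis ⟨i, c, k⟩) =
    ∑ c', B.mat i c' c • B.toBasis ⟨i, c', k⟩ := by
  obtain ⟨k, hk⟩ := k
  rw [semisimplePart, LinearMap.sub_apply]
  cases k with
  | zero => rw [B.apply_zero, B.nilpotentPart_zero, sub_zero]
  | succ k => rw [B.apply_succ, B.nilpotentPart_succ, add_sub_cancel_right]

theorem semisimplePart_add_nilpotentPart : B.semisimplePart + B.nilpotentPart = A :=
  sub_add_cancel _ _

theorem semisimplePart_nilpotentPart (x : V) :
    B.semisimplePart (B.nilpotentPart x) = B.nilpotentPart (B.semisimplePart x) := by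
  have : B.semisimplePart ∘ₗ B.nilpotentPart = B.nilpotentPart ∘ₗ B.semisimplePart := by
    refine B.toBasis.ext ?_
    rintro ⟨i, c, k, hk⟩
    rw [LinearMap.comp_apply, LinearMap.comp_apply, semisimplePart_apply, map_sum]
    cases k with
    | zero => simp [nilpotentPart_zero]
    | succ k => simp [nilpotentPart_succ, semisimplePart_apply]
  exact LinearMap.congr_fun this x

/-- The coordinate of a vector at the `k`-th place of a chain; it is `0` beyond the chain. -/
def coord (i : Fin J.num) (c : Fin (B.mult i)) (k : ℕ) : V →ₗ[ℝ] ℝ :=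
  if h : k < J.size i then B.toBasis.coord ⟨i, c, ⟨k, h⟩⟩ else 0

theorem coord_of_lt {i c k} (h : k < J.size i) (x : V) :
    B.coord i c k x = B.toBasis.repr x ⟨i, c, ⟨k, h⟩⟩ := by
  rw [coord, dif_pos h, Basis.coord_apply]

theorem coord_of_le {i c k} (h : J.size i ≤ k) (x : V) : B.coord i c k x = 0 := by
  rw [coord, dif_neg (not_lt.2 h), LinearMap.zero_apply]

theorem coord_toBasis (i c k i' c') (k' : Fin (J.size i')) :
    B.coord i c k (B.toBasis ⟨i', c', k'⟩) =
      if (⟨i', c'⟩ : Σ i, Fin (B.mult i)) = ⟨i, c⟩ ∧ (k' : ℕ) = k then 1 else 0 := by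
  classical
  rcases lt_or_ge k (J.size i) with h | h
  · rw [coord_of_lt _ h, Basis.repr_self, Finsupp.single_apply]
    refine if_congr ⟨fun hh => ?_, fun hh => ?_⟩ rfl rfl
    · cases hh
      exact ⟨rfl, rfl⟩
    · obtain ⟨h1, h2⟩ := hh
      cases h1
      cases h2
      rfl
  · rw [coord_of_le _ h, if_neg]
    rintro ⟨h1, h2⟩
    cases h1
    have := k'.2
    omega

/-- Setting `coord` to zero beyond the end of a chain makes the shift formula valid at its last
position as well. -/
theorem coord_nilpotentPart (i c k) (x : V) :
    B.coord i c k (B.nilpotentPart x) = B.coord i c (k + 1) x := by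
  have : B.coord i c k ∘ₗ B.nilpotentPart = B.coord i c (k + 1) := by
    refine B.toBasis.ext ?_
    rintro ⟨i', c', k', hk'⟩
    rw [LinearMap.comp_apply, coord_toBasis]
    cases k' with
    | zero => simp [nilpotentPart_zero]
    | succ k' =>
      rw [nilpotentPart_succ, coord_toBasis]
      exact if_congr (and_congr_right fun _ => Nat.succ_inj.symm) rfl rfl
  exact LinearMap.congr_fun this x

theorem coord_nilpotentPart_pow (i c k l) (x : V) :
    B.coord i c k ((B.nilpotentPart ^ l) x) = B.coord i c (k + l) x := by
  induction l generalizing k with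
  | zero => simp
  | succ l ih => rw [pow_succ', Module.End.mul_apply, coord_nilpotentPart, ih, add_right_comm,
      add_assoc]

theorem ext_coord {x y : V} (h : ∀ i c k, k < J.size i → B.coord i c k x = B.coord i c k y) :
    x = y := by
  refine B.toBasis.ext_elem ?_
  rintro ⟨i, c, k, hk⟩
  rw [← coord_of_lt, ← coord_of_lt, h i c k hk]

theorem coord_semisimplePart (i c k) (x : V) :
    B.coord i c k (B.semisimplePart x) = ∑ c', B.mat i c c' * B.coord i c' k x := by
  have : B.coord i c k ∘ₗ B.semisimplePart = ∑ c', B.mat i c c' • B.coord i c' k := by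
    refine B.toBasis.ext ?_
    rintro ⟨i', c', k'⟩
    rw [LinearMap.comp_apply, semisimplePart_apply, map_sum, LinearMap.sum_apply]
    simp only [map_smul, LinearMap.smul_apply, coord_toBasis, smul_eq_mul]
    by_cases hi : i' = i
    · subst hi
      by_cases hk : (k' : ℕ) = k
      · simp [hk]
      · simp [hk]
    · simp [hi]
  have := LinearMap.congr_fun this x
  simpa using this

theorem mem_ker_nilpotentPart_pow {l : ℕ} {x : V} :
    x ∈ LinearMap.ker (B.nilpotentPart ^ l) ↔ ∀ i c k, l ≤ k → B.coord i c k x = 0 := by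
  rw [LinearMap.mem_ker]
  constructor
  · intro h i c k hk
    obtain ⟨k, rfl⟩ := Nat.exists_eq_add_of_le' hk
    rw [← coord_nilpotentPart_pow, h, map_zero]
  · intro h
    refine B.ext_coord fun i c k _ => ?_
    rw [coord_nilpotentPart_pow, h i c _ (Nat.le_add_left _ _), map_zero]

theorem isNilpotent_nilpotentPart : IsNilpotent B.nilpotentPart := by
  refine ⟨J.sMax, LinearMap.ext fun x => ?_⟩
  rw [LinearMap.zero_apply, ← LinearMap.mem_ker, mem_ker_nilpotentPart_pow]
  exact fun i c k hk => B.coord_of_le ((Finset.le_sup (Finset.mem_univ i)).trans hk) x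

/-- The coordinates with respect to a Jordan basis, as a point of Euclidean space. -/
def toEuclidean : V ≃ₗ[ℝ] EuclideanSpace ℝ (Σ i, Fin (B.mult i) × Fin (J.size i)) :=
  B.toBasis.equivFun.trans (WithLp.linearEquiv 2 ℝ _).symm

theorem toEuclidean_apply (x : V) (i c k) :
    B.toEuclidean x ⟨i, c, k⟩ = B.coord i c k x := by
  rw [coord_of_lt _ k.2]
  rfl

theorem inner_toEuclidean (x y : V) : inner ℝ (B.toEuclidean x) (B.toEuclidean y) =
    ∑ i, ∑ k : Fin (J.size i), ∑ c, B.coord i c k x * B.coord i c k y := by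
  rw [PiLp.inner_apply, Fintype.sum_sigma]
  refine Finset.sum_congr rfl fun i _ => ?_
  rw [Fintype.sum_prod_type, Finset.sum_comm]
  refine Finset.sum_congr rfl fun k _ => Finset.sum_congr rfl fun c _ => ?_
  rw [toEuclidean_apply, toEuclidean_apply]
  simp [mul_comm]

/-- `S` acts on each layer of a block, with the position `k` fixed, by one and the same
skew-symmetric matrix. -/
theorem inner_semisimplePart (x y : V) :
    inner ℝ (B.toEuclidean (B.semisimplePart x)) (B.toEuclidean y) =
      -inner ℝ (B.toEuclidean x) (B.toEuclidean (B.semisimplePart y)) := by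
  rw [inner_toEuclidean, inner_toEuclidean]
  simp only [coord_semisimplePart, Finset.sum_mul, Finset.mul_sum, ← Finset.sum_neg_distrib]
  refine Finset.sum_congr rfl fun i _ => Finset.sum_congr rfl fun k _ => ?_
  rw [Finset.sum_comm]
  refine Finset.sum_congr rfl fun c _ => Finset.sum_congr rfl fun c' _ => ?_
  rw [B.mat_skew i c' c]
  ring

/-- Real eigenvectors are killed by `N` by `nilpotent_apply_eq_zero`; conversely, `ker N` is spanned
by the first vectors of the chains. From here on the complexification is no longer needed. -/
theorem eigenSum_eq_ker : eigenSum A = LinearMap.ker B.nilpotentPart := by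
  refine le_antisymm (iSup_le fun α x hx => ?_) fun x hx => ?_
  · refine nilpotent_apply_eq_zero (T := B.toEuclidean.toLinearMap) B.toEuclidean.injective
      B.inner_semisimplePart B.semisimplePart_nilpotentPart B.isNilpotent_nilpotentPart (α := α) ?_
    rw [semisimplePart_add_nilpotentPart]
    by_cases hα : α = 0
    · subst hα
      exact Or.inl ⟨rfl, apply_eq_zero_of_mem_realEigenspace_zero hx⟩
    · exact Or.inr ⟨hα, apply_apply_of_mem_realEigenspace hx⟩
  · rw [← pow_one B.nilpotentPart, mem_ker_nilpotentPart_pow] at hx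
    rw [← B.toBasis.sum_repr x]
    refine Submodule.sum_mem _ fun p _ => ?_
    obtain ⟨i, c, k, hk⟩ := p
    cases k with
    | zero => exact Submodule.smul_mem _ _ (B.mem_eigenSum i c hk)
    | succ k =>
      rw [← B.coord_of_lt hk, hx i c _ (Nat.le_add_left 1 k), zero_smul]
      exact Submodule.zero_mem _

theorem finrank_span_image {ι : Type*} [Fintype ι] (b : Basis ι ℝ V) (p : ι → Prop)
    [DecidablePred p] : finrank ℝ (Submodule.span ℝ (b '' {x | p x})) =
      ∑ x, if p x then 1 else 0 := by
  have h := finrank_span_eq_card (b.linearIndependent.comp (Subtype.val : {x // p x} → ι)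
    Subtype.val_injective)
  rw [Set.range_comp, Subtype.range_coe_subtype] at h
  rw [← Finset.card_filter, ← Fintype.card_subtype]
  exact h

theorem mem_span_image_iff {p : (Σ i, Fin (B.mult i) × Fin (J.size i)) → Prop} {x : V} :
    x ∈ Submodule.span ℝ (B.toBasis '' {y | p y}) ↔
      ∀ i c k (h : k < J.size i), ¬ p ⟨i, c, ⟨k, h⟩⟩ → B.coord i c k x = 0 := by
  rw [Basis.mem_span_image]
  constructor
  · intro h i c k hk hp
    rw [B.coord_of_lt hk]
    by_contra h0
    exact hp (h (Finsupp.mem_support_iff.2 h0))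
  · rintro h ⟨i, c, k, hk⟩ hy
    by_contra h0
    refine Finsupp.mem_support_iff.1 hy ?_
    rw [← B.coord_of_lt hk, h i c k hk h0]

/-- The kernel is spanned by the basis vectors at positions below `l`, so a chain contributes the
minimum of its length and `l`. -/
theorem finrank_ker_nilpotentPart_pow (l : ℕ) :
    finrank ℝ (LinearMap.ker (B.nilpotentPart ^ l)) =
      ∑ i, B.mult i * min (J.size i) l := by
  have h : LinearMap.ker (B.nilpotentPart ^ l) =
      Submodule.span ℝ (B.toBasis '' {y | (y.2.2 : ℕ) < l}) := by
    ext x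
    rw [mem_ker_nilpotentPart_pow, mem_span_image_iff]
    refine ⟨fun h i c k _ hk => h i c k (not_lt.1 hk), fun h i c k hk => ?_⟩
    rcases lt_or_ge k (J.size i) with h1 | h1
    · exact h i c k h1 (not_lt.2 hk)
    · exact B.coord_of_le h1 x
  rw [h, finrank_span_image, Fintype.sum_sigma]
  refine Finset.sum_congr rfl fun i _ => ?_
  have h1 : (∑ k : Fin (J.size i), if (k : ℕ) < l then 1 else 0) = min (J.size i) l := by
    rw [Fin.sum_univ_eq_sum_range (fun k => if k < l then 1 else 0), ← Finset.card_filter, show (Finset.range (J.size i)).filter (· < l) = Finset.range (min (J.size i) l) by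
      ext; simp, Finset.card_range]
  rw [Fintype.sum_prod_type, Finset.sum_const_nat (m := min (J.size i) l), Finset.card_univ,
    Fintype.card_fin]
  exact fun _ _ => h1

theorem finrank_eq_sum : finrank ℝ V = ∑ i, B.mult i * J.size i := by
  rw [finrank_eq_card_basis B.toBasis]
  simp

theorem sumOfSize_eq (s : ℕ) :
    J.sumOfSize s = Submodule.span ℝ (B.toBasis '' {y | J.size y.1 = s}) := by
  rw [RealJordanDecomposition.sumOfSize]
  refine le_antisymm (iSup_le fun i => ?_) ?_
  · rw [← B.span_block, Submodule.span_le]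
    rintro _ ⟨a, rfl⟩
    exact Submodule.subset_span ⟨⟨i.1, a⟩, i.2, rfl⟩
  · rw [Submodule.span_le]
    rintro _ ⟨⟨i, a⟩, h, rfl⟩
    refine Submodule.mem_iSup_of_mem ⟨i, h⟩ ?_
    rw [← B.span_block]
    exact Submodule.subset_span ⟨a, rfl⟩

theorem d_eq (s : ℕ) : J.d s = ∑ i, if J.size i = s then B.mult i else 0 := by
  have h : J.sumOfSize s ⊓ eigenSum A =
      Submodule.span ℝ (B.toBasis '' {y | J.size y.1 = s ∧ (y.2.2 : ℕ) = 0}) := by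
    ext x
    rw [Submodule.mem_inf, B.sumOfSize_eq, B.eigenSum_eq_ker, ← pow_one B.nilpotentPart,
      mem_ker_nilpotentPart_pow, mem_span_image_iff, mem_span_image_iff]
    refine ⟨fun ⟨h1, h2⟩ i c k hk h => ?_, fun h => ⟨fun i c k hk h1 => h i c k hk fun h2 => h1 h2.1,
      fun i c k hk => ?_⟩⟩
    · by_cases h3 : J.size i = s
      · exact h2 i c k (Nat.one_le_iff_ne_zero.2 fun h4 => h ⟨h3, h4⟩)
      · exact h1 i c k hk h3
    · rcases lt_or_ge k (J.size i) with h1 | h1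
      · exact h i c k h1 fun h2 => by
          have : k = 0 := h2.2
          omega
      · exact B.coord_of_le h1 x
  rw [RealJordanDecomposition.d, h, finrank_span_image, Fintype.sum_sigma]
  refine Finset.sum_congr rfl fun i _ => ?_
  have h1 : (∑ k : Fin (J.size i), if J.size i = s ∧ (k : ℕ) = 0 then 1 else 0) =
      if J.size i = s then 1 else 0 := by
    have := J.size_pos i
    rw [Fin.sum_univ_eq_sum_range (fun k => if J.size i = s ∧ k = 0 then 1 else 0)]
    split_ifs with hi
    · simp only [hi, true_and, Finset.sum_ite_eq', Finset.mem_range]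
      exact if_pos (by omega)
    · simp [hi]
  rw [Fintype.sum_prod_type, Finset.sum_const_nat (m := if J.size i = s then 1 else 0),
    Finset.card_univ, Fintype.card_fin, mul_ite, mul_one, mul_zero]
  exact fun _ _ => h1

/-- A chain of length `r ≥ s` has `r - (s - 1)` basis vectors outside the kernel, a shorter chain
none, and `d r` is the number of chains of length `r`. -/
theorem finrank_ker_nilpotentPart_pow_eq {s : ℕ} (hs : 1 ≤ s) :
    (finrank ℝ (LinearMap.ker (B.nilpotentPart ^ (s - 1))) : ℤ) = (finrank ℝ V : ℤ) -
      ∑ r ∈ Finset.Icc s J.sMax, ((r : ℤ) + 1 - s) * (J.d r : ℤ) := by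
  simp only [B.d_eq, B.finrank_ker_nilpotentPart_pow, B.finrank_eq_sum, Nat.cast_sum,
    Finset.mul_sum]
  rw [Finset.sum_comm, ← Finset.sum_sub_distrib]
  refine Finset.sum_congr rfl fun i _ => ?_
  simp only [Nat.cast_ite, Nat.cast_zero, mul_ite, mul_zero]
  rw [Finset.sum_ite_eq]
  have hle : J.size i ≤ J.sMax := Finset.le_sup (Finset.mem_univ i)
  push_cast [hs]
  split_ifs with h
  · rw [Finset.mem_Icc] at h
    rw [min_eq_right (by omega)]
    ring
  · rw [Finset.mem_Icc, not_and'] at h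
    have := h hle
    rw [min_eq_left (by omega), sub_zero]

theorem blockComponent_toBasis (i i' a) :
    J.blockComponent i (B.toBasis ⟨i', a⟩) = if i' = i then B.toBasis ⟨i', a⟩ else 0 := by
  have hmem : B.toBasis ⟨i', a⟩ ∈ J.block i' := by
    rw [← B.span_block]
    exact Submodule.subset_span ⟨a, rfl⟩
  have h1 : (LinearEquiv.ofBijective (DirectSum.coeLinearMap J.block) J.internal).symm
      (B.toBasis ⟨i', a⟩) = DirectSum.lof ℝ _ (fun i => J.block i) i' ⟨_, hmem⟩ := by
    rw [LinearEquiv.symm_apply_eq]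
    exact (DirectSum.coeLinearMap_lof J.block i' ⟨_, hmem⟩).symm
  rw [RealJordanDecomposition.blockComponent]
  simp only [LinearMap.comp_apply, LinearEquiv.coe_coe, h1]
  split_ifs with h
  · subst h
    rw [DirectSum.component.lof_self]
    rfl
  · rw [DirectSum.component.of, dif_neg h, map_zero]

theorem coord_component (r i c k) (x : V) :
    B.coord i c k (J.component r x) = if J.size i = r then B.coord i c k x else 0 := by
  have : B.coord i c k ∘ₗ J.component r = if J.size i = r then B.coord i c k else 0 := by
    refine B.toBasis.ext ?_
    rintro ⟨i', c', k'⟩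
    rw [LinearMap.comp_apply, RealJordanDecomposition.component, LinearMap.sum_apply]
    simp only [blockComponent_toBasis]
    rw [Finset.sum_ite_eq]
    simp only [Finset.mem_filter, Finset.mem_univ, true_and]
    by_cases hi : i' = i
    · subst hi
      split_ifs <;> simp
    · split_ifs <;> simp [coord_toBasis, hi]
  rw [← LinearMap.comp_apply, this]
  split_ifs <;> rfl

/-- The vectors of the first summand `ker N` with vanishing components in the short Jordan
subspaces are in the range of a power of `N`. -/
theorem exists_nilpotentPart_pow_eq {s : ℕ} {x : V} (hx : x ∈ eigenSum A)
    (hxs : ∀ r, 1 ≤ r → r < s → J.component r x = 0) :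
    ∃ y, (B.nilpotentPart ^ (s - 1)) y = x := by
  rw [B.eigenSum_eq_ker, ← pow_one B.nilpotentPart, mem_ker_nilpotentPart_pow] at hx
  have key : ∀ p, B.toBasis.repr x p • B.toBasis p ∈ LinearMap.range (B.nilpotentPart ^ (s - 1)) := by
    rintro ⟨i, c, k, hk⟩
    rcases Nat.eq_zero_or_pos k with rfl | hk0
    · by_cases hs : J.size i < s
      · have h1 := congrArg (B.coord i c 0) (hxs _ (J.size_pos i) hs)
        rw [coord_component, if_pos rfl, map_zero, coord_of_lt _ hk] at h1
        rw [h1, zero_smul]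
        exact Submodule.zero_mem _
      -- Positions count from `0`, so the first vector of a chain of length at least `s` is the
      -- image of the one at position `s - 1`.
      · refine Submodule.smul_mem _ _ ⟨B.toBasis ⟨i, c, ⟨s - 1, by omega⟩⟩, ?_⟩
        refine B.ext_coord fun i' c' k' _ => ?_
        rw [coord_nilpotentPart_pow, coord_toBasis, coord_toBasis]
        refine if_congr (and_congr_right fun _ => ?_) rfl rfl
        dsimp only
        omega
    · rw [← B.coord_of_lt hk, hx i c k hk0, zero_smul]
      exact Submodule.zero_mem _
  have h : x ∈ LinearMap.range (B.nilpotentPart ^ (s - 1)) := by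
    rw [← B.toBasis.sum_repr x]
    exact Submodule.sum_mem _ fun p _ => key p
  exact h

/-- On chains of length `s` the operator `N ^ s` vanishes, so its range has no component there. -/
theorem nilpotentPart_pow_ne {s : ℕ} {x : V} (hs : J.component s x ≠ 0) (hx : x ∈ eigenSum A)
    (y : V) : (B.nilpotentPart ^ s) y ≠ x := by
  rintro rfl
  rw [B.eigenSum_eq_ker, ← pow_one B.nilpotentPart, mem_ker_nilpotentPart_pow] at hx
  refine hs (B.ext_coord fun i c k hk => ?_)
  rw [coord_component, map_zero]
  split_ifs with h
  · rw [coord_nilpotentPart_pow, B.coord_of_le (by omega)]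
  · rfl

end JordanBasis

/-! ### The linear flow of a sum of a skew-adjoint and a nilpotent endomorphism -/

section LinearFlow

variable {V : Type*} [NormedAddCommGroup V] [NormedSpace ℝ V] [FiniteDimensional ℝ V]

theorem expFlow_add_of_commute {S N : End ℝ V} (h : ∀ x, S (N x) = N (S x)) (t : ℝ) :
    expFlow (S + N) t = expFlow S t * expFlow N t := by
  have : CompleteSpace V := FiniteDimensional.complete ℝ V
  let _ : NormedAlgebra ℚ (V →L[ℝ] V) := NormedAlgebra.restrictScalars ℚ ℝ _
  have hc : Commute (LinearMap.toContinuousLinearMap S) (LinearMap.toContinuousLinearMap N) :=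
    ContinuousLinearMap.ext h
  rw [expFlow, map_add, smul_add, NormedSpace.exp_add_of_commute]
  · rfl
  · exact (hc.smul_left t).smul_right t

theorem hasDerivAt_expFlow_apply (S : End ℝ V) (v : V) (t : ℝ) :
    HasDerivAt (fun t => expFlow S t v) (S (expFlow S t v)) t := by
  have : CompleteSpace V := FiniteDimensional.complete ℝ V
  exact (hasDerivAt_exp_smul_const' (LinearMap.toContinuousLinearMap S) t).clm_apply
    (hasDerivAt_const t v) |>.congr_deriv (by simp [expFlow])

theorem expFlow_apply_of_pow_eq_zero (N : End ℝ V) {k : ℕ} {y : V} (h : (N ^ (k + 1)) y = 0)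
    (t : ℝ) : expFlow N t y =
      ∑ j ∈ Finset.range (k + 1), ((j.factorial : ℝ)⁻¹ * t ^ j) • (N ^ j) y := by
  have : CompleteSpace V := FiniteDimensional.complete ℝ V
  have hpow : ∀ j, (LinearMap.toContinuousLinearMap N ^ j) y = (N ^ j) y := by
    intro j
    induction j with
    | zero => rfl
    | succ j ih =>
      rw [pow_succ', pow_succ', Module.End.mul_apply, ← ih]
      rfl
  have h1 := (NormedSpace.exp_series_hasSum_exp' (𝕂 := ℝ)
    (t • LinearMap.toContinuousLinearMap N)).mapL (ContinuousLinearMap.apply ℝ V y)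
  have h2 : HasSum (fun j : ℕ => ((j.factorial : ℝ)⁻¹ * t ^ j) • (N ^ j) y) (expFlow N t y) := by
    convert! h1 using 2 with j
    simp [smul_pow, smul_smul, hpow]
  refine h2.unique (hasSum_sum_of_ne_finset_zero fun j hj => ?_)
  rw [Finset.mem_range, not_lt] at hj
  rw [← Nat.sub_add_cancel hj, pow_add N, Module.End.mul_apply, h, map_zero, smul_zero]

/-- The flow of an endomorphism that is skew-adjoint for some inner product is bounded. -/
theorem exists_norm_expFlow_le {E : Type*} [NormedAddCommGroup E] [InnerProductSpace ℝ E]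
    {S : End ℝ V} (T : V ≃ₗ[ℝ] E)
    (hskew : ∀ x y, inner ℝ (T (S x)) (T y) = -inner ℝ (T x) (T (S y))) :
    ∃ C : ℝ, 0 < C ∧ ∀ t v, ‖expFlow S t v‖ ≤ C * ‖v‖ := by
  have : FiniteDimensional ℝ E := T.finiteDimensional
  let T' : V ≃L[ℝ] E := T.toContinuousLinearEquiv
  have hconst : ∀ t v, ‖T' (expFlow S t v)‖ = ‖T' v‖ := by
    intro t v
    have hd : ∀ t, HasDerivAt (fun t => inner ℝ (T' (expFlow S t v)) (T' (expFlow S t v))) 0 t := by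
      intro t
      have h1 : HasDerivAt (fun t => T' (expFlow S t v)) (T' (S (expFlow S t v))) t :=
        (T' : V →L[ℝ] E).hasFDerivAt.comp_hasDerivAt t (hasDerivAt_expFlow_apply S v t)
      refine (h1.inner ℝ h1).congr_deriv ?_
      have h2 := hskew (expFlow S t v) (expFlow S t v)
      change inner ℝ (T _) (T _) + inner ℝ (T _) (T _) = 0
      rw [h2, add_neg_cancel]
    have h3 := is_const_of_deriv_eq_zero (fun t => (hd t).differentiableAt)
      (fun t => (hd t).deriv) t 0
    simp only [expFlow_zero, one_apply_eq_self, real_inner_self_eq_norm_sq] at h3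
    exact (sq_eq_sq₀ (norm_nonneg _) (norm_nonneg _)).1 h3
  -- The summand `1` keeps the constant positive even when `V` is trivial.
  refine ⟨‖(T'.symm : E →L[ℝ] V)‖ * ‖(T' : V →L[ℝ] E)‖ + 1, by positivity, fun t v => ?_⟩
  calc ‖expFlow S t v‖ = ‖(T'.symm : E →L[ℝ] V) (T' (expFlow S t v))‖ := by simp
    _ ≤ ‖(T'.symm : E →L[ℝ] V)‖ * ‖T' v‖ := by
      rw [← hconst t v]
      exact ContinuousLinearMap.le_opNorm _ _
    _ ≤ ‖(T'.symm : E →L[ℝ] V)‖ * (‖(T' : V →L[ℝ] E)‖ * ‖v‖) := by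
      gcongr
      exact (T' : V →L[ℝ] E).le_opNorm v
    _ ≤ _ := by
      rw [← mul_assoc, add_mul, one_mul]
      exact le_add_of_nonneg_right (norm_nonneg v)

/-- By boundedness the operators `exp (n S)` converge along some subsequence `φ`. The gaps `φ (2n) -
φ n ≥ n` tend to infinity, and the corresponding operators tend to the identity because the inverses
`exp (-φ n S)` are bounded too. One sequence serves all vectors, which is what allows two
trajectories to be compared. -/
theorem exists_tendsto_expFlow_one {S : End ℝ V} {C : ℝ} (hC : 0 < C)
    (h : ∀ t v, ‖expFlow S t v‖ ≤ C * ‖v‖) :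
    ∃ u : ℕ → ℝ, Tendsto u atTop atTop ∧ Tendsto (fun n => expFlow S (u n)) atTop (𝓝 1) := by
  have : ProperSpace (V →L[ℝ] V) := FiniteDimensional.proper ℝ _
  have hn : ∀ t, ‖expFlow S t‖ ≤ C := fun t =>
    ContinuousLinearMap.opNorm_le_bound _ hC.le (h t)
  obtain ⟨L, -, φ, hφ, hL⟩ := (isCompact_closedBall (0 : V →L[ℝ] V) C).tendsto_subseq
    (x := fun n : ℕ => expFlow S n) fun n => mem_closedBall_zero_iff.2 (hn n)
  have hL2 : Tendsto (fun n : ℕ => expFlow S (φ (2 * n))) atTop (𝓝 L) :=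
    hL.comp (tendsto_id.const_mul_atTop' two_pos)
  refine ⟨fun n => φ (2 * n) - φ n, ?_, ?_⟩
  · refine tendsto_atTop_mono (fun n => ?_) tendsto_natCast_atTop_atTop
    have h1 : n + φ n ≤ φ (n + n) := hφ.add_le_nat n n
    rw [← two_mul] at h1
    have h2 : (n : ℝ) + φ n ≤ φ (2 * n) := by exact_mod_cast h1
    linarith
  · rw [tendsto_iff_norm_sub_tendsto_zero]
    have hz : Tendsto (fun n : ℕ => ‖expFlow S (φ (2 * n)) - expFlow S (φ n)‖ * C) atTop (𝓝 0) := by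
      have := (hL2.sub hL).norm.mul_const C
      simpa using this
    refine squeeze_zero (fun _ => norm_nonneg _) (fun n => ?_) hz
    have h1 : expFlow S (φ (2 * n) - φ n) - 1 =
        (expFlow S (φ (2 * n)) - expFlow S (φ n)) * expFlow S (-φ n) := by
      rw [sub_mul, ← expFlow_add, ← expFlow_add, add_neg_cancel, expFlow_zero,
        ← sub_eq_add_neg]
    rw [h1]
    exact (norm_mul_le _ _).trans (by gcongr; exact hn _)

end LinearFlow

/-! ### Asymptotics of the projective flow -/

section ProjectiveFlow

variable {V : Type*} [NormedAddCommGroup V] [NormedSpace ℝ V]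

theorem norm_unitVec_sub_unitVec_le {a b : V} (ha : a ≠ 0) (hb : b ≠ 0) :
    ‖unitVec a - unitVec b‖ ≤ 2 * ‖a - b‖ / ‖a‖ := by
  have ha' : 0 < ‖a‖ := norm_pos_iff.2 ha
  have hb' : 0 < ‖b‖ := norm_pos_iff.2 hb
  have h1 : unitVec a - unitVec b = ‖a‖⁻¹ • (a - b) + (‖a‖⁻¹ - ‖b‖⁻¹) • b := by
    simp only [unitVec, smul_sub, sub_smul]
    abel
  have h2 : ‖(‖a‖⁻¹ - ‖b‖⁻¹) • b‖ ≤ ‖a‖⁻¹ * ‖a - b‖ := by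
    rw [norm_smul, Real.norm_eq_abs,
      show (‖a‖⁻¹ - ‖b‖⁻¹) = ‖a‖⁻¹ * (‖b‖ - ‖a‖) * ‖b‖⁻¹ by field_simp, abs_mul, abs_mul,
      abs_of_pos (inv_pos.2 ha'), abs_of_pos (inv_pos.2 hb'), mul_assoc, inv_mul_cancel₀ hb'.ne',
      mul_one, norm_sub_rev a b]
    gcongr
    exact abs_norm_sub_norm_le b a
  rw [h1]
  refine (norm_add_le _ _).trans ?_
  rw [norm_smul, norm_inv, norm_norm, mul_div_assoc, two_mul, div_eq_inv_mul]
  exact add_le_add le_rfl h2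

theorem mk_smul {v : V} {a : ℝ} (ha : a ≠ 0) (hv : v ≠ 0) :
    Projectivization.mk ℝ (a • v) (smul_ne_zero ha hv) = Projectivization.mk ℝ v hv := by
  rw [Projectivization.mk_eq_mk_iff']
  exact ⟨a, rfl⟩

variable [FiniteDimensional ℝ V] {A S N : End ℝ V}

theorem expFlow_ne_zero (A : End ℝ V) (t : ℝ) {v : V} (hv : v ≠ 0) : expFlow A t v ≠ 0 := fun h =>
  hv (expFlow_injective A t (h.trans (map_zero _).symm))

theorem projFlow_mk (A : End ℝ V) (t : ℝ) {v : V} (hv : v ≠ 0) :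
    projFlow A t (Projectivization.mk ℝ v hv) =
      Projectivization.mk ℝ (expFlow A t v) (expFlow_ne_zero A t hv) := rfl

theorem expFlow_add_apply_of_ker (hc : ∀ x, S (N x) = N (S x)) {x : V} (hx : N x = 0) (t : ℝ) :
    expFlow (S + N) t x = expFlow S t x := by
  rw [expFlow_add_of_commute hc, mul_apply_eq_comp,
    expFlow_apply_of_pow_eq_zero N (k := 0) (by simpa using hx)]
  simp

theorem tendsto_smul_expFlow_nilpotent {k : ℕ} {y : V} (hz : N ((N ^ k) y) = 0) :
    Tendsto (fun t : ℝ => ((k.factorial : ℝ) * (t ^ k)⁻¹) • expFlow N t y) atTop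
      (𝓝 ((N ^ k) y)) := by
  have h1 : (N ^ (k + 1)) y = 0 := by rw [pow_succ', Module.End.mul_apply, hz]
  simp only [expFlow_apply_of_pow_eq_zero N h1, Finset.sum_range_succ, smul_add, Finset.smul_sum]
  rw [← zero_add ((N ^ k) y)]
  refine Tendsto.add ?_ ?_
  · rw [← Finset.sum_const_zero (s := Finset.range k)]
    refine tendsto_finsetSum _ fun j hj => ?_
    rw [Finset.mem_range] at hj
    simp only [smul_smul]
    rw [← zero_smul ℝ ((N ^ j) y)]
    refine Tendsto.smul_const ?_ _
    have h2 : Tendsto (fun t : ℝ => (k.factorial : ℝ) * (j.factorial : ℝ)⁻¹ * (t ^ (k - j))⁻¹) atTop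
        (𝓝 ((k.factorial : ℝ) * (j.factorial : ℝ)⁻¹ * 0)) :=
      ((tendsto_pow_atTop (by omega)).inv_tendsto_atTop).const_mul _
    rw [mul_zero] at h2
    refine h2.congr' ?_
    filter_upwards [eventually_gt_atTop 0] with t ht
    have h3 : t ^ k = t ^ (k - j) * t ^ j := by rw [← pow_add, Nat.sub_add_cancel hj.le]
    rw [h3]
    field_simp
  · rw [zero_add]
    refine tendsto_const_nhds.congr' ?_
    filter_upwards [eventually_gt_atTop 0] with t ht
    rw [smul_smul, show (k.factorial : ℝ) * (t ^ k)⁻¹ * ((k.factorial : ℝ)⁻¹ * t ^ k) = 1 by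
      have := k.factorial_ne_zero
      field_simp, one_smul]

/-- Rescaling `y` by `k! / t ^ k` does not change its line. The two trajectories then differ by `exp
(tS)` applied to a vector tending to zero, while `exp (tS) z` stays away from zero. -/
theorem tendsto_dist_projFlow {C : ℝ} (hC : 0 < C) (hS : ∀ t v, ‖expFlow S t v‖ ≤ C * ‖v‖)
    (hc : ∀ x, S (N x) = N (S x)) {k : ℕ} {y : V} (hy : y ≠ 0) (hz0 : (N ^ k) y ≠ 0)
    (hz : N ((N ^ k) y) = 0) :
    Tendsto (fun t => dist (projFlow (S + N) t (Projectivization.mk ℝ _ hz0))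
      (projFlow (S + N) t (Projectivization.mk ℝ y hy))) atTop (𝓝 0) := by
  set z := (N ^ k) y with hzdef
  have hlim : Tendsto (fun t : ℝ => 2 * (C * ‖z - ((k.factorial : ℝ) * (t ^ k)⁻¹) • expFlow N t y‖) /
      (C⁻¹ * ‖z‖)) atTop (𝓝 0) := by
    have h1 := (tendsto_const_nhds (x := z)).sub (tendsto_smul_expFlow_nilpotent (N := N) (y := y)
      (k := k) hz)
    rw [← hzdef, sub_self] at h1
    have h2 := ((h1.norm.const_mul C).const_mul 2).div_const (C⁻¹ * ‖z‖)
    simpa using h2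
  refine squeeze_zero' (Eventually.of_forall fun _ => dist_nonneg) ?_ hlim
  filter_upwards [eventually_gt_atTop 0] with t ht
  have hct : (k.factorial : ℝ) * (t ^ k)⁻¹ ≠ 0 := by
    have := k.factorial_ne_zero
    positivity
  set c := (k.factorial : ℝ) * (t ^ k)⁻¹ with hcdef
  have hyt := expFlow_ne_zero (S + N) t hy
  have hzt := expFlow_ne_zero (S + N) t hz0
  rw [projFlow_mk, projFlow_mk, ← mk_smul hct hyt, dist_mk]
  refine (min_le_left _ _).trans ((norm_unitVec_sub_unitVec_le hzt (smul_ne_zero hct hyt)).trans ?_)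
  have h1 : expFlow (S + N) t z - c • expFlow (S + N) t y =
      expFlow S t (z - c • expFlow N t y) := by
    rw [expFlow_add_apply_of_ker hc hz, expFlow_add_of_commute hc, mul_apply_eq_comp,
      map_sub, map_smul]
  -- The lower bound is the upper bound for time `-t`.
  have h2 : C⁻¹ * ‖z‖ ≤ ‖expFlow (S + N) t z‖ := by
    rw [expFlow_add_apply_of_ker hc hz, inv_mul_le_iff₀ hC]
    have h3 := hS (-t) (expFlow S t z)
    rw [← mul_apply_eq_comp, ← expFlow_add, neg_add_cancel, expFlow_zero] at h3
    exact h3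
  have h4 : 0 < ‖z‖ := norm_pos_iff.2 hz0
  rw [h1]
  gcongr
  exact hS _ _

theorem tendsto_projectivization_mk {V : Type*} [NormedAddCommGroup V] [NormedSpace ℝ V]
    {ι : Type*} {l : Filter ι} {f : ι → V} {x : V}
    (hf : Tendsto f l (𝓝 x)) (hf0 : ∀ i, f i ≠ 0) (hx0 : x ≠ 0) :
    Tendsto (fun i => Projectivization.mk ℝ (f i) (hf0 i)) l (𝓝 (Projectivization.mk ℝ x hx0)) := by
  have h1 : Continuous fun v : {v : V // v ≠ 0} => Projectivization.mk ℝ v.1 v.2 :=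
    continuous_subtype_val.projectivization_mk _
  have h2 : Tendsto (fun i => (⟨f i, hf0 i⟩ : {v : V // v ≠ 0})) l (𝓝 ⟨x, hx0⟩) :=
    tendsto_subtype_rng.2 hf
  exact Tendsto.comp (h1.tendsto ⟨x, hx0⟩) h2

theorem tendsto_projFlow_of_ker {u : ℕ → ℝ} (hu : Tendsto (fun n => expFlow S (u n)) atTop (𝓝 1))
    (hc : ∀ x, S (N x) = N (S x)) {x : V} (hx0 : x ≠ 0) (hx : N x = 0) :
    Tendsto (fun n => projFlow (S + N) (u n) (Projectivization.mk ℝ x hx0)) atTop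
      (𝓝 (Projectivization.mk ℝ x hx0)) := by
  have h1 : Tendsto (fun n => expFlow (S + N) (u n) x) atTop (𝓝 x) := by
    simp only [expFlow_add_apply_of_ker hc hx]
    exact ((ContinuousLinearMap.apply ℝ V x).continuous.tendsto _).comp hu
  have h2 := tendsto_projectivization_mk h1 (fun n => expFlow_ne_zero (S + N) (u n) hx0) hx0
  simp only [projFlow_mk]
  exact h2

theorem mk_mem_recurrentSet {u : ℕ → ℝ} (hut : Tendsto u atTop atTop)
    (hu : Tendsto (fun n => expFlow S (u n)) atTop (𝓝 1)) (hc : ∀ x, S (N x) = N (S x)) {x : V}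
    (hx0 : x ≠ 0) (hx : N x = 0) :
    Projectivization.mk ℝ x hx0 ∈ recurrentSet (projFlow (S + N)) := by
  rw [recurrentSet, Set.mem_ofPred_eq, mem_omegaLimit_iff_frequently]
  intro n hn
  have h1 : ∀ᶠ k in atTop, projFlow (S + N) (u k) (Projectivization.mk ℝ x hx0) ∈ n :=
    (tendsto_projFlow_of_ker hu hc hx0 hx).eventually hn
  exact hut.frequently (h1.mono fun k hk => ⟨_, rfl, hk⟩).frequently

/-- Along the common return times both points come back to themselves, so the limit of their
distance is their own distance. -/
theorem mk_eq_mk_of_tendsto_dist {u : ℕ → ℝ} (hut : Tendsto u atTop atTop)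
    (hu : Tendsto (fun n => expFlow S (u n)) atTop (𝓝 1)) (hc : ∀ x, S (N x) = N (S x)) {x z : V}
    (hx0 : x ≠ 0) (hx : N x = 0) (hz0 : z ≠ 0) (hz : N z = 0)
    (h : Tendsto (fun t => dist (projFlow (S + N) t (Projectivization.mk ℝ x hx0))
      (projFlow (S + N) t (Projectivization.mk ℝ z hz0))) atTop (𝓝 0)) :
    Projectivization.mk ℝ x hx0 = Projectivization.mk ℝ z hz0 := by
  have h1 := (tendsto_projFlow_of_ker hu hc hx0 hx).dist (tendsto_projFlow_of_ker hu hc hz0 hz)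
  exact dist_eq_zero.1 (tendsto_nhds_unique h1 (h.comp hut))

end ProjectiveFlow

/-! ### The dimension of the stable manifolds -/

section StableManifold

variable {V : Type*} [NormedAddCommGroup V] [NormedSpace ℝ V]

theorem continuous_projectivization_map {E : Type*} [NormedAddCommGroup E] [NormedSpace ℝ E]
    {L : E →ₗ[ℝ] V} (hL : Continuous L) (hinj : Function.Injective L) :
    Continuous (Projectivization.map L hinj) := by
  rw [(isOpenQuotientMap_mk' (V := E)).isQuotientMap.continuous_iff]
  have h0 : ∀ v : {v : E // v ≠ 0}, L v ≠ 0 := fun v h =>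
    v.2 (hinj (h.trans (map_zero L).symm))
  exact (hL.comp continuous_subtype_val).projectivization_mk h0

theorem exists_pow_apply_ne_zero {N : End ℝ V} (hN : IsNilpotent N) {y : V} (hy : y ≠ 0) :
    ∃ k, (N ^ k) y ≠ 0 ∧ N ((N ^ k) y) = 0 := by
  classical
  have h : ∃ k, (N ^ k) y = 0 := hN.imp fun k hk => by rw [hk, LinearMap.zero_apply]
  obtain ⟨k, hk⟩ : ∃ k, Nat.find h = k + 1 := Nat.exists_eq_succ_of_ne_zero fun h0 => hy <| by
    simpa [h0] using Nat.find_spec h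
  refine ⟨k, Nat.find_min h (by omega), ?_⟩
  have h1 := Nat.find_spec h
  rwa [hk, pow_succ', Module.End.mul_apply] at h1

theorem smul_add_eq_zero_iff {N : End ℝ V} {m : ℕ} {x y₀ : V} (hx0 : x ≠ 0)
    (hy₀ : (N ^ m) y₀ = x) {a : ℝ} {v : V}
    (hv : v ∈ LinearMap.ker (N ^ m)) : a • y₀ + v = 0 ↔ a = 0 ∧ v = 0 := by
  refine ⟨fun h => ?_, fun ⟨h1, h2⟩ => by rw [h1, h2, zero_smul, zero_add]⟩
  have h1 := congrArg (N ^ m) h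
  rw [map_add, map_smul, hy₀, LinearMap.mem_ker.1 hv, add_zero, map_zero, smul_eq_zero] at h1
  have h2 := h1.resolve_right hx0
  refine ⟨h2, ?_⟩
  rwa [h2, zero_smul, zero_add] at h

variable [FiniteDimensional ℝ V] {S N : End ℝ V} {C : ℝ} {m : ℕ} {x y₀ : V}

theorem mk_mem_stableManifold (hC : 0 < C) (hS : ∀ t v, ‖expFlow S t v‖ ≤ C * ‖v‖)
    (hc : ∀ x, S (N x) = N (S x)) (hx0 : x ≠ 0) (hx : N x = 0) {y : V} (hy : y ≠ 0)
    (h : (N ^ m) y = x) :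
    Projectivization.mk ℝ y hy ∈
      stableManifold (projFlow (S + N)) (Projectivization.mk ℝ x hx0) := by
  subst h
  exact tendsto_dist_projFlow hC hS hc hy hx0 hx

/-- The line of `y` is asymptotic to that of its last nonzero iterate `N ^ k y`, which must then be
the line of `x`. For `k < m` already `y` is in the kernel, for `k = m` a multiple of `y₀` has to be
subtracted, and `k > m` would put `x` into the range of `N ^ (m + 1)`. -/
theorem exists_sub_smul_mem_ker (hN : IsNilpotent N) (hC : 0 < C)
    (hS : ∀ t v, ‖expFlow S t v‖ ≤ C * ‖v‖) (hc : ∀ x, S (N x) = N (S x)) {u : ℕ → ℝ}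
    (hut : Tendsto u atTop atTop) (hu : Tendsto (fun n => expFlow S (u n)) atTop (𝓝 1))
    (hx0 : x ≠ 0) (hx : N x = 0) (hy₀ : (N ^ m) y₀ = x) (hne : ∀ y, (N ^ (m + 1)) y ≠ x)
    {y : V} (hy : y ≠ 0) (h : Projectivization.mk ℝ y hy ∈
      stableManifold (projFlow (S + N)) (Projectivization.mk ℝ x hx0)) :
    ∃ a : ℝ, y - a • y₀ ∈ LinearMap.ker (N ^ m) := by
  obtain ⟨k, hk0, hk⟩ := exists_pow_apply_ne_zero hN hy
  have h1 := tendsto_dist_projFlow hC hS hc hy hk0 hk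
  have h2 : Tendsto (fun t => dist (projFlow (S + N) t (Projectivization.mk ℝ x hx0))
      (projFlow (S + N) t (Projectivization.mk ℝ _ hk0))) atTop (𝓝 0) := by
    rw [stableManifold, Set.mem_ofPred_eq] at h
    refine squeeze_zero (fun _ => dist_nonneg) (fun t => dist_triangle_right _ _
      (projFlow (S + N) t (Projectivization.mk ℝ y hy))) ?_
    simpa [dist_comm] using h.add h1
  have h3 := mk_eq_mk_of_tendsto_dist hut hu hc hx0 hx hk0 hk h2
  obtain ⟨a, ha⟩ := (Projectivization.mk_eq_mk_iff' ℝ _ _ _ _).1 h3.symm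
  have ha0 : a ≠ 0 := fun h => hk0 (by rw [← ha, h, zero_smul])
  rcases lt_trichotomy k m with hkm | rfl | hkm
  · refine ⟨0, ?_⟩
    rw [LinearMap.mem_ker, zero_smul, sub_zero, show m = (m - (k + 1)) + (1 + k) by omega,
      pow_add, pow_add, pow_one, Module.End.mul_apply, Module.End.mul_apply, hk, map_zero]
  · refine ⟨a, ?_⟩
    rw [LinearMap.mem_ker, map_sub, map_smul, hy₀, ha, sub_self]
  · refine absurd ?_ (hne (a⁻¹ • (N ^ (k - (m + 1))) y))
    rw [map_smul, ← Module.End.mul_apply, ← pow_add, Nat.add_sub_cancel' hkm, ← ha, smul_smul,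
      inv_mul_cancel₀ ha0, one_smul]

/-- `W` lies in the projective space of `ℝ y₀ ⊕ ker (N ^ m)`. The sum is identified with a Euclidean
space because the bound for projective spaces needs an inner product. -/
theorem hasSmallInductiveDimensionLT_of_forall_exists (hx0 : x ≠ 0) (hy₀ : (N ^ m) y₀ = x)
    {W : Set (ℙ ℝ V)} (hW : ∀ (y : V) (hy : y ≠ 0), Projectivization.mk ℝ y hy ∈ W →
      ∃ a : ℝ, y - a • y₀ ∈ LinearMap.ker (N ^ m)) :
    HasSmallInductiveDimensionLT W (finrank ℝ (LinearMap.ker (N ^ m)) + 1) := by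
  set K := LinearMap.ker (N ^ m)
  have hfin : finrank ℝ (EuclideanSpace ℝ (Fin (finrank ℝ K + 1))) = finrank ℝ (ℝ × K) := by
    rw [finrank_euclideanSpace_fin, finrank_prod, finrank_self, add_comm]
  let e := LinearEquiv.ofFinrankEq _ _ hfin
  let L : (EuclideanSpace ℝ (Fin (finrank ℝ K + 1))) →ₗ[ℝ] V :=
    ((LinearMap.toSpanSingleton ℝ V y₀).coprod K.subtype) ∘ₗ e.toLinearMap
  have hinj : Function.Injective L := by
    rw [LinearMap.coe_comp]
    refine Function.Injective.comp ?_ e.injective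
    rw [injective_iff_map_eq_zero]
    rintro ⟨a, v⟩ h
    have h1 := (smul_add_eq_zero_iff hx0 hy₀ v.2).1 (by simpa using h)
    exact Prod.ext h1.1 (Subtype.ext h1.2)
  have hdim := hasSmallInductiveDimensionLT_projectivization
    (E := EuclideanSpace ℝ (Fin (finrank ℝ K + 1)))
  rw [finrank_euclideanSpace_fin] at hdim
  refine HasSmallInductiveDimensionLT.of_range_subset
    (continuous_projectivization_map L.continuous_of_finiteDimensional hinj)
    (Projectivization.map_injective L hinj) hdim (IsInducing.subtypeVal (t := W)) ?_
  rintro ⟨p, hp⟩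
  induction p using Projectivization.ind with | h y hy
  obtain ⟨a, ha⟩ := hW y hy hp
  have hL : L (e.symm (a, ⟨_, ha⟩)) = y := by
    simp [L]
  have h0 : e.symm (a, ⟨_, ha⟩) ≠ 0 := fun h => hy (by rw [← hL, h, map_zero])
  refine ⟨Projectivization.mk ℝ _ h0, ?_⟩
  rw [Projectivization.map_mk]
  simp only [hL]

/-- The affine chart `v ↦ [y₀ + v]` on `ker (N ^ m)` has values in `W`; restricted to a compact ball
it is an embedding. Applying `N ^ m` shows that proportional values are equal. -/
theorem not_hasSmallInductiveDimensionLT_of_forall_mem (hx0 : x ≠ 0) (hy₀ : (N ^ m) y₀ = x)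
    {W : Set (ℙ ℝ V)} (hW : ∀ (y : V) (hy : y ≠ 0), (N ^ m) y = x →
      Projectivization.mk ℝ y hy ∈ W) :
    ¬ HasSmallInductiveDimensionLT W (finrank ℝ (LinearMap.ker (N ^ m))) := by
  set K := LinearMap.ker (N ^ m)
  intro hdim
  let e : EuclideanSpace ℝ (Fin (finrank ℝ K)) ≃ₗ[ℝ] K :=
    LinearEquiv.ofFinrankEq _ _ finrank_euclideanSpace_fin
  have hpow : ∀ v, (N ^ m) (y₀ + e v) = x := fun v => by
    rw [map_add, hy₀, LinearMap.mem_ker.1 (e v).2, add_zero]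
  have h0 : ∀ v, y₀ + (e v : V) ≠ 0 := fun v h => hx0 (by rw [← hpow v, h, map_zero])
  let g : Metric.closedBall (0 : EuclideanSpace ℝ (Fin (finrank ℝ K))) (1 / 2) → W := fun v =>
    ⟨Projectivization.mk ℝ (y₀ + e v.1) (h0 v), hW _ _ (hpow v)⟩
  have hcont : Continuous e := e.toLinearMap.continuous_of_finiteDimensional
  have hg : Continuous g := Continuous.subtype_mk
    ((continuous_const.add (continuous_subtype_val.comp
      (hcont.comp continuous_subtype_val))).projectivization_mk _) _
  have hginj : Function.Injective g := fun v w hvw => by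
    obtain ⟨a, ha⟩ := (Projectivization.mk_eq_mk_iff' ℝ _ _ _ _).1 (congrArg Subtype.val hvw)
    have h1 := congrArg (N ^ m) ha
    rw [map_smul, hpow, hpow] at h1
    have h2 : a = 1 := smul_left_injective ℝ hx0 (by simpa using h1)
    rw [h2, one_smul, add_right_inj] at ha
    exact Subtype.ext (e.injective (Subtype.ext ha.symm))
  have : CompactSpace (Metric.closedBall (0 : EuclideanSpace ℝ (Fin (finrank ℝ K))) (1 / 2)) :=
    isCompact_iff_compactSpace.1 (isCompact_closedBall _ _)
  exact not_hasSmallInductiveDimensionLT_closedBall _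
    (HasSmallInductiveDimensionLT.of_isInducing (hg.isClosedEmbedding hginj).isInducing hdim)

end StableManifold

end

/-! ### Recurrence and dimension on the strata -/

theorem lemma6 {V : Type*} [NormedAddCommGroup V] [NormedSpace ℝ V] [FiniteDimensional ℝ V]
    (A : Module.End ℝ V) (hA : HasImaginarySpectrum A) :
    Nonempty (RealJordanDecomposition A) ∧
    ∀ (J : RealJordanDecomposition A) (s : ℕ), 1 ≤ s → s ≤ J.sMax →
      ∃ D : ℕ,
        (D : ℤ) = (Module.finrank ℝ V : ℤ) -
          ∑ i ∈ Finset.Icc s J.sMax, ((i : ℤ) + 1 - (s : ℤ)) * (J.d i : ℤ) ∧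
        ∀ p ∈ J.recSubspace s \ J.recSubspace (s + 1),
          p ∈ recurrentSet (projFlow A) ∧
          smallInductiveDimension ↥(stableManifold (projFlow A) p) = (D : WithBot ℕ∞) := by
  refine ⟨nonempty_realJordanDecomposition hA, fun J s hs _ => ?_⟩
  obtain ⟨B⟩ := nonempty_jordanBasis J
  obtain ⟨C, hC, hS⟩ := exists_norm_expFlow_le B.toEuclidean B.inner_semisimplePart
  obtain ⟨u, hut, hu⟩ := exists_tendsto_expFlow_one hC hS
  have hc := B.semisimplePart_nilpotentPart
  -- The witness is the dimension of `ker (N ^ (s - 1))`, which does not depend on the point.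
  refine ⟨_, B.finrank_ker_nilpotentPart_pow_eq hs, ?_⟩
  rintro p ⟨⟨x, hx0, rfl, hx, hxs⟩, hp⟩
  -- Otherwise the same vector `x` would place the point in the next stratum.
  have hcomp : J.component s x ≠ 0 := fun h => hp ⟨x, hx0, rfl, hx, fun r hr hrs => by
    rcases Nat.lt_succ_iff_lt_or_eq.1 hrs with h1 | rfl
    exacts [hxs r hr h1, h]⟩
  have hNx : B.nilpotentPart x = 0 := by
    rw [B.eigenSum_eq_ker] at hx
    exact hx
  obtain ⟨y₀, hy₀⟩ := B.exists_nilpotentPart_pow_eq hx hxs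
  have hne : ∀ y, (B.nilpotentPart ^ (s - 1 + 1)) y ≠ x := by
    rw [Nat.sub_add_cancel hs]
    exact B.nilpotentPart_pow_ne hcomp hx
  have hAB : projFlow A = projFlow (B.semisimplePart + B.nilpotentPart) := by
    rw [B.semisimplePart_add_nilpotentPart]
  rw [hAB]
  refine ⟨mk_mem_recurrentSet hut hu hc hx0 hNx, smallInductiveDimension_eq _ ?_ ?_⟩
  · exact hasSmallInductiveDimensionLT_of_forall_exists hx0 hy₀ fun y hy h =>
      exists_sub_smul_mem_ker B.isNilpotent_nilpotentPart hC hS hc hut hu hx0 hNx hy₀ hne hy h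
  · exact not_hasSmallInductiveDimensionLT_of_forall_mem hx0 hy₀ fun y hy h =>
      mk_mem_stableManifold hC hS hc hx0 hNx hy h
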